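/- Let $1\le K<\infty$ be an integer and let $\mathbb T=\mathbb R/\mathbb Z$ be the one-dimensional torus. For $0\le k,l\le K$ let $\phi_{k,l}\in C^\infty(\mathbb T^2)$ be nonnegative, with $\phi_{0,l}\equiv 0$ for all $l$ and $\phi_{k,K}\equiv 0$ for all $k$. Let $\psi\in C^\infty(\mathbb T)$ satisfy $0<\psi(u)<K$ for all $u\in\mathbb T$. For $N\ge 1$ let $(\eta^N_t)_{t\ge 0}$ be the continuous-time Markov process with state space $\{0,1,\dots,K\}^N$ and generator $$\mathcal L_N f(\eta)=\frac1N\sum_{i=1}^N\sum_{j\ne i}\sum_{k=0}^K\sum_{l=0}^K \phi_{k,l}\Big(\frac iN,\frac jN\Big)1_{\{\eta(i)=k,\ \eta(j)=l\}}\big(f(\eta^{(i,j)})-f(\eta)\big),$$ where $\eta^{(i,j)}$ is obtained from $\eta$ by moving one particle from position $i$ to position $j$, and suppose that the coordinates $\eta^N_0(i)$, $1\le i\le N$, are independent with $\eta^N_0(i)$ having the binomial distribution $B(K,\psi(i/N)/K)$. For $0\le k\le K$, $t\ge0$ and $f\in C(\mathbb T)$ put $$\mu^N_{t,k}(f)=\frac1N\sum_{i=1}^N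 1_{\{\eta^N_t(i)=k\}}f(i/N).$$ For $\rho=(\rho_0,\dots,\rho_K)\in C(\mathbb T)^{K+1}$ write $$\mathrm{Out}_k[\rho](u)=\sum_{l=0}^K\int_{\mathbb T}\phi_{k,l}(u,v)\rho_l(v)\,dv,\qquad \mathrm{In}_k[\rho](u)=\sum_{l=1}^K\int_{\mathbb T}\phi_{l,k}(v,u)\rho_l(v)\,dv .$$ Consider the $C(\mathbb T)^{K+1}$-valued ordinary differential equation (with respect to the norm $\max_k\sup_u|\rho_k(u)|$) for $t\mapsto\rho^K_t=(\rho^K_{t,0},\dots,\rho^K_{t,K})$: $$\frac{d}{dt}\rho^K_{t,k}=-\rho^K_{t,k}\,\mathrm{Out}_k[\rho^K_t]-\rho^K_{t,k}\,\mathrm{In}_k[\rho^K_t]+\rho^K_{t,k-1}\,\mathrm{In}_{k-1}[\rho^K_t]+\rho^K_{t,k+1}\,\mathrm{Out}_{k+1}[\rho^K_t],\quad 1\le k\le K-1,$$ $$\frac{d}{dt}\rho^K_{t,0}=\rho^K_{t,1}\,\mathrm{Out}_1[\rho^K_t]-\rho^K_{t,0}\,\mathrm{In}_0[\rho^K_t],\qquad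 \frac{d}{dt}\rho^K_{t,K}=\rho^K_{t,K-1}\,\mathrm{In}_{K-1}[\rho^K_t]-\rho^K_{t,K}\,\mathrm{Out}_K[\rho^K_t],$$ $$\rho^K_{0,k}(u)=\binom Kk\Big(\frac{\psi(u)}K\Big)^k\Big(1-\frac{\psi(u)}K\Big)^{K-k},\qquad 0\le k\le K .$$ Then this equation has a solution $(\rho^K_t)_{t\in[0,\infty)}$ on all of $[0,\infty)$, and it is unique. Moreover, for every $t\ge 0$, every $0\le k\le K$ and every $f\in C(\mathbb T)$, $$\lim_{N\to\infty}\mu^N_{t,k}(f)=\int_{\mathbb T}\rho^K_{t,k}(u)f(u)\,du\quad\text{in }L^2 .$$ -/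

import Mathlib

open scoped NNReal

noncomputable section

namespace MeanField

/-- Smoothness of a function on the torus `ℝ / ℤ`: its `1`-periodic lift to `ℝ` is `C^∞`. -/
def SmoothOnTorus (ψ : UnitAddCircle → ℝ) : Prop :=
  ContDiff ℝ ((⊤ : ℕ∞) : WithTop ℕ∞) (fun x : ℝ => ψ (x : UnitAddCircle))

/-- Smoothness of a function on the two-dimensional torus: its periodic lift to `ℝ × ℝ`
is `C^∞`. -/
def SmoothOnTorus₂ (φ : UnitAddCircle → UnitAddCircle → ℝ) : Prop :=
  ContDiff ℝ ((⊤ : ℕ∞) : WithTop ℕ∞)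
    (fun p : ℝ × ℝ => φ (p.1 : UnitAddCircle) (p.2 : UnitAddCircle))

/-- The jump rate functions `φ_{k,l}`, `0 ≤ k, l ≤ K`: smooth and nonnegative on the
two-dimensional torus, with `φ_{0,l} ≡ 0` (no jump from an empty position) and
`φ_{k,K} ≡ 0` (no jump to a full position). -/
structure JumpRates (K : ℕ) where
  rate : Fin (K + 1) → Fin (K + 1) → UnitAddCircle → UnitAddCircle → ℝ
  smooth : ∀ k l, SmoothOnTorus₂ (rate k l)
  nonneg : ∀ k l u v, 0 ≤ rate k l u v
  zero_left : ∀ l u v, rate 0 l u v = 0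
  last_right : ∀ k u v, rate k (Fin.last K) u v = 0

/-- The set of smooth `ψ` on the torus with `0 < ψ < K` everywhere. -/
def admissibleProfiles (K : ℕ) : Set (UnitAddCircle → ℝ) :=
  {ψ | SmoothOnTorus ψ ∧ ∀ u, 0 < ψ u ∧ ψ u < K}

/-- Configurations: at most `K` particles at each of `N` positions. -/
abbrev Config (K N : ℕ) : Type := Fin N → Fin (K + 1)

/-- The macroscopic point of the positions `1, …, N` (here numbered `0, …, N - 1`):
`1/N, 2/N, …, N/N` on the torus. -/
def site (N : ℕ) (i : Fin N) : UnitAddCircle :=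
  ((((i : ℕ) : ℝ) + 1) / (N : ℝ) : ℝ)

/-- The configuration `η^{(i,j)}` after a particle has moved from `i` to `j`, for `i ≠ j`.
The truncations at `0` and `K` are active only when position `i` is empty or position `j` is
full, in which case the jump rate is zero. -/
def moveParticle {K N : ℕ} (η : Config K N) (i j : Fin N) : Config K N := fun x =>
  if x = i then ⟨(η i : ℕ) - 1, by have := (η i).isLt; omega⟩
  else if x = j then ⟨min ((η j : ℕ) + 1) K, by omega⟩
  else η x

/-- The generator of the particle system on `N` positions. -/
def generator {K : ℕ} (φ : JumpRates K) (N : ℕ) (f : Config K N → ℝ) (η : Config K N) : ℝ :=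
  (1 / (N : ℝ)) * ∑ i : Fin N, ∑ j ∈ Finset.univ.erase i,
    ∑ k : Fin (K + 1), ∑ l : Fin (K + 1),
      φ.rate k l (site N i) (site N j) * (if η i = k ∧ η j = l then 1 else 0) *
        (f (moveParticle η i j) - f η)

/-- The matrix of the generator: its `(η, ξ)` entry is the generator applied to the indicator
function of `ξ`, evaluated at `η`. -/
def generatorMatrix {K : ℕ} (φ : JumpRates K) (N : ℕ) :
    Matrix (Config K N) (Config K N) ℝ :=
  Matrix.of fun η ξ => generator φ N (Pi.single ξ 1) η

/-- `X` is a continuous-time Markov process on the finite state space `S` with generator matrix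
`Q`, i.e. with transition semigroup `exp (t Q)`: for all times `t 0 ≤ t 1 ≤ ⋯ ≤ t (n + 1)` and all
states, `P(X_{t 0} = x 0, …, X_{t (n+1)} = x (n+1))` equals
`P(X_{t 0} = x 0, …, X_{t n} = x n) * exp ((t (n+1) - t n) Q) (x n, x (n+1))`.
No regularity of the paths is required, so that every version of the process is covered,
in particular the càdlàg one. -/
structure IsMarkovProcess {S Ω : Type*} [Fintype S] [DecidableEq S] [MeasurableSpace Ω]
    (Q : Matrix S S ℝ) (P : MeasureTheory.Measure Ω) (X : ℝ≥0 → Ω → S) : Prop where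
  measurable : ∀ (t : ℝ≥0) (x : S), MeasurableSet {ω | X t ω = x}
  markov : ∀ (t : ℕ → ℝ≥0), Monotone t → ∀ (x : ℕ → S) (n : ℕ),
    P.real {ω | ∀ i ≤ n + 1, X (t i) ω = x i} =
      P.real {ω | ∀ i ≤ n, X (t i) ω = x i} *
        NormedSpace.exp (((t (n + 1) : ℝ) - (t n : ℝ)) • Q) (x n) (x (n + 1))

/-- The probability of `k` under the binomial distribution `B(K, p)`. -/
def binomialMass (K : ℕ) (p : ℝ) (k : Fin (K + 1)) : ℝ :=
  (K.choose k : ℝ) * p ^ (k : ℕ) * (1 - p) ^ (K - (k : ℕ))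

/-- The random configuration `ξ` has independent coordinates, the one at `i` being distributed as
`B(K, ψ(i/N)/K)`. -/
def HasBinomialLaw {K N : ℕ} {Ω : Type*} [MeasurableSpace Ω] (ψ : UnitAddCircle → ℝ)
    (P : MeasureTheory.Measure Ω) (ξ : Ω → Config K N) : Prop :=
  ∀ x : Config K N,
    P.real {ω | ξ ω = x} = ∏ i : Fin N, binomialMass K (ψ (site N i) / (K : ℝ)) (x i)

/-- `μ_k(f)`, the integral of `f` against the empirical measure of the positions that hold `k`
particles. -/
def empirical {K N : ℕ} (η : Config K N) (k : Fin (K + 1)) (f : C(UnitAddCircle, ℝ)) : ℝ :=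
  (1 / (N : ℝ)) * ∑ i : Fin N, (if η i = k then 1 else 0) * f (site N i)

/-- `∑_{l=0}^K ∫ φ_{k,l}(u,v) g_l(v) dv`. -/
def outRate {K : ℕ} (φ : JumpRates K) (g : Fin (K + 1) → C(UnitAddCircle, ℝ))
    (k : Fin (K + 1)) (u : UnitAddCircle) : ℝ :=
  ∑ l : Fin (K + 1), ∫ v : UnitAddCircle, φ.rate k l u v * g l v

/-- `∑_{l=1}^K ∫ φ_{l,k}(v,u) g_l(v) dv`. -/
def inRate {K : ℕ} (φ : JumpRates K) (g : Fin (K + 1) → C(UnitAddCircle, ℝ))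
    (k : Fin (K + 1)) (u : UnitAddCircle) : ℝ :=
  ∑ l : Fin K, ∫ v : UnitAddCircle, φ.rate l.succ k v u * g l.succ v

/-- The right-hand side of the mean-field equation, for `K ≥ 1`. In each of the three cases the
additions and subtractions in `Fin (K + 1)` do not wrap around. -/
def meanFieldRHS {K : ℕ} (φ : JumpRates K) (g : Fin (K + 1) → C(UnitAddCircle, ℝ))
    (k : Fin (K + 1)) (u : UnitAddCircle) : ℝ :=
  if k = 0 then
    g (k + 1) u * outRate φ g (k + 1) u - g k u * inRate φ g k u
  else if k = Fin.last K then
    g (k - 1) u * inRate φ g (k - 1) u - g k u * outRate φ g k u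
  else
    - g k u * outRate φ g k u - g k u * inRate φ g k u
      + g (k - 1) u * inRate φ g (k - 1) u + g (k + 1) u * outRate φ g (k + 1) u

/-- `ρ` solves the `C(𝕋)^{K+1}`-valued mean-field equation on `[0, ∞)`, with binomial initial
value. The time derivative is taken in the Banach space `C(𝕋)^{K+1}` with the maximum norm
(one-sided at time `0`). -/
structure IsMeanFieldSolution {K : ℕ} (φ : JumpRates K) (ψ : UnitAddCircle → ℝ)
    (ρ : ℝ≥0 → Fin (K + 1) → C(UnitAddCircle, ℝ)) : Prop where
  initial : ∀ k u, ρ 0 k u = binomialMass K (ψ u / (K : ℝ)) k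
  hasDeriv : ∀ t : ℝ≥0, ∃ D : Fin (K + 1) → C(UnitAddCircle, ℝ),
    HasDerivWithinAt (fun s : ℝ => ρ s.toNNReal) D (Set.Ici 0) (t : ℝ) ∧
      ∀ k u, D k u = meanFieldRHS φ (ρ t) k u

end MeanField

end

noncomputable section

namespace MeanField

/-! Existence. The vector field is quadratic, so it is only locally Lipschitz. Composed with the
pointwise truncation `clip` to `[0, 1]` it becomes bounded and globally Lipschitz, and
Picard–Lindelöf then works on every interval `[0, T]`. The truncated equation keeps probability
profiles: a negative component has no loss term, and the total mass is conserved
(`isStochastic_of_clipped`). On such profiles the truncation does nothing, so the original equation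
is solved. Uniqueness is local Lipschitz continuity plus boundedness on compact time intervals.

Convergence. Only the one-time laws of the process matter, and they solve the forward equation of a
finite matrix. For an observable `g`, let the deviation be the average of `g i (η i)` over the
positions minus its value under the profile. The drift of the average is quadratic in the
configuration. Replacing the empirical rates by those of the profile leaves the deviation of another
observable, `driftTest`, and errors that are themselves deviations of the kernels `φ(u, ·)` and
`φ(·, u)` (`abs_drift_sub_le`). All these observables are bounded uniformly in `N`, so the
derivative of the second moment of one deviation is at most a constant times the supremum of the
second moments over all `|g| ≤ 1`, plus an error from `1/N` and from Riemann sums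
(`abs_secondMomentDeriv_le`).

To apply Grönwall to that supremum, note that the second moment is convex in `g`. Its supremum over
the cube is therefore attained at a vertex, and it is the maximum norm of a differentiable curve
with finitely many components, one for each choice of signs (`secondMoment_le`). The number of
components grows with `N`, but the constants do not. At time `0`, independence gives `4/N`
(`secondMoment_initial_le`). -/

/-- Families `(ρ_0, …, ρ_K)` of continuous functions on the torus, with the maximum norm. -/
abbrev Profile (K : ℕ) : Type := Fin (K + 1) → C(UnitAddCircle, ℝ)

/-- The level `k - 1`, truncated at `0`. -/
def lower {K : ℕ} (k : Fin (K + 1)) : Fin (K + 1) :=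
  ⟨(k : ℕ) - 1, by have := k.isLt; omega⟩

/-- The level `k + 1`, truncated at `K`. -/
def raise {K : ℕ} (k : Fin (K + 1)) : Fin (K + 1) :=
  ⟨min ((k : ℕ) + 1) K, by omega⟩

theorem raise_castSucc {K : ℕ} (k : Fin K) : raise k.castSucc = k.succ := by
  ext; simp [raise]

theorem lower_succ {K : ℕ} (k : Fin K) : lower k.succ = k.castSucc := by
  ext; simp [lower]

theorem SmoothOnTorus.continuous {ψ : UnitAddCircle → ℝ} (h : SmoothOnTorus ψ) :
    Continuous ψ :=
  (QuotientAddGroup.isOpenQuotientMap_mk (N := AddSubgroup.zmultiples (1 : ℝ))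
    ).isQuotientMap.continuous_iff.2 (ContDiff.continuous h)

/-- Products of quotient maps need not be quotient maps, but products of open ones are. Beyond this
continuity, smoothness of the rates plays no role. -/
theorem SmoothOnTorus₂.continuous {φ : UnitAddCircle → UnitAddCircle → ℝ}
    (h : SmoothOnTorus₂ φ) : Continuous (fun p : UnitAddCircle × UnitAddCircle => φ p.1 p.2) :=
  ((QuotientAddGroup.isOpenQuotientMap_mk (N := AddSubgroup.zmultiples (1 : ℝ))).prodMap
    (QuotientAddGroup.isOpenQuotientMap_mk (N := AddSubgroup.zmultiples (1 : ℝ)))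
    ).isQuotientMap.continuous_iff.2 (ContDiff.continuous h)

/-! ### Rates and the mean-field vector field -/

section Rates

variable {K : ℕ} (φ : JumpRates K)

theorem JumpRates.continuous (k l : Fin (K + 1)) :
    Continuous (fun p : UnitAddCircle × UnitAddCircle => φ.rate k l p.1 p.2) :=
  (φ.smooth k l).continuous

theorem JumpRates.exists_bound : ∃ R : ℝ, 1 ≤ R ∧ ∀ k l u v, φ.rate k l u v ≤ R := by
  have h : ∀ k l, ∃ R : ℝ, ∀ u v, φ.rate k l u v ≤ R := fun k l => by
    obtain ⟨R, hR⟩ := (isCompact_range (φ.continuous k l)).bddAbove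
    exact ⟨R, fun u v => hR ⟨(u, v), rfl⟩⟩
  choose R hR using h
  refine ⟨1 + ∑ k, ∑ l, |R k l|, ?_, fun k l u v => ?_⟩
  · have : 0 ≤ ∑ k, ∑ l, |R k l| := by positivity
    linarith
  · have h1 : |R k l| ≤ ∑ l, |R k l| :=
      Finset.single_le_sum (f := fun l => |R k l|) (fun _ _ => abs_nonneg _) (Finset.mem_univ l)
    have h2 : ∑ l, |R k l| ≤ ∑ k, ∑ l, |R k l| :=
      Finset.single_le_sum (f := fun k => ∑ l, |R k l|)
        (fun _ _ => Finset.sum_nonneg fun _ _ => abs_nonneg _) (Finset.mem_univ k)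
    linarith [hR k l u v, le_abs_self (R k l)]

/-- An upper bound of all jump rates. -/
def JumpRates.bound : ℝ := φ.exists_bound.choose

theorem JumpRates.one_le_bound : 1 ≤ φ.bound := φ.exists_bound.choose_spec.1

theorem JumpRates.le_bound (k l : Fin (K + 1)) (u v : UnitAddCircle) :
    φ.rate k l u v ≤ φ.bound := φ.exists_bound.choose_spec.2 k l u v

theorem JumpRates.abs_le_bound (k l : Fin (K + 1)) (u v : UnitAddCircle) :
    |φ.rate k l u v| ≤ φ.bound := by
  rw [abs_of_nonneg (φ.nonneg k l u v)]
  exact φ.le_bound k l u v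

/-- The rate `φ_{k,l}(u, ·)` as a continuous function. -/
def JumpRates.outKernel (k l : Fin (K + 1)) (u : UnitAddCircle) : C(UnitAddCircle, ℝ) :=
  ⟨fun v => φ.rate k l u v, (φ.continuous k l).comp (by fun_prop : Continuous fun v => (u, v))⟩

/-- The rate `φ_{l,k}(·, u)` as a continuous function. -/
def JumpRates.inKernel (k l : Fin (K + 1)) (u : UnitAddCircle) : C(UnitAddCircle, ℝ) :=
  ⟨fun v => φ.rate l k v u, (φ.continuous l k).comp (by fun_prop : Continuous fun v => (v, u))⟩

@[simp]
theorem JumpRates.outKernel_apply (k l : Fin (K + 1)) (u v : UnitAddCircle) :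
    φ.outKernel k l u v = φ.rate k l u v := rfl

@[simp]
theorem JumpRates.inKernel_apply (k l : Fin (K + 1)) (u v : UnitAddCircle) :
    φ.inKernel k l u v = φ.rate l k v u := rfl

theorem JumpRates.continuous_outKernel (k l : Fin (K + 1)) : Continuous (φ.outKernel k l) :=
  ContinuousMap.continuous_of_continuous_uncurry _ (φ.continuous k l)

theorem JumpRates.continuous_inKernel (k l : Fin (K + 1)) : Continuous (φ.inKernel k l) :=
  ContinuousMap.continuous_of_continuous_uncurry _
    ((φ.continuous l k).comp (by fun_prop : Continuous fun p : _ × _ => (p.2, p.1)))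

theorem integrable_continuousMap (f : C(UnitAddCircle, ℝ)) :
    MeasureTheory.Integrable (fun u => f u) :=
  f.continuous.integrable_of_hasCompactSupport (HasCompactSupport.of_compactSpace _)

theorem outRate_eq (g : Profile K) (k : Fin (K + 1)) (u : UnitAddCircle) :
    outRate φ g k u = ∑ l, ∫ v : UnitAddCircle, (φ.outKernel k l u * g l) v := rfl

/-- Since `φ_{0,k} ≡ 0`, the level `0` may be added to the sum, which puts both rates in the same
form. -/
theorem inRate_eq (g : Profile K) (k : Fin (K + 1)) (u : UnitAddCircle) :
    inRate φ g k u = ∑ l, ∫ v : UnitAddCircle, (φ.inKernel k l u * g l) v := by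
  rw [Fin.sum_univ_succ]
  simp [inRate, φ.zero_left]

theorem outRate_zero (g : Profile K) (u : UnitAddCircle) : outRate φ g 0 u = 0 := by
  simp [outRate, φ.zero_left]

theorem inRate_last (g : Profile K) (u : UnitAddCircle) : inRate φ g (Fin.last K) u = 0 := by
  simp [inRate, φ.last_right]

theorem continuous_integral_mul {a : UnitAddCircle → C(UnitAddCircle, ℝ)} (ha : Continuous a)
    (g : C(UnitAddCircle, ℝ)) :
    Continuous fun u => ∫ v : UnitAddCircle, (a u * g) v := by
  have : Continuous (Function.uncurry fun (u v : UnitAddCircle) => (a u * g) v) := by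
    have h1 : Continuous fun p : UnitAddCircle × UnitAddCircle => a p.1 * g := by fun_prop
    exact h1.eval continuous_snd
  simpa using continuous_parametric_integral_of_continuous (μ := MeasureTheory.volume) this
    isCompact_univ

theorem continuous_outRate (g : Profile K) (k : Fin (K + 1)) : Continuous (outRate φ g k) := by
  simp only [funext (outRate_eq φ g k)]
  exact continuous_finsetSum _ fun l _ => continuous_integral_mul (φ.continuous_outKernel k l) _

theorem continuous_inRate (g : Profile K) (k : Fin (K + 1)) : Continuous (inRate φ g k) := by
  simp only [funext (inRate_eq φ g k)]
  exact continuous_finsetSum _ fun l _ => continuous_integral_mul (φ.continuous_inKernel k l) _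

theorem integral_mul_sub (a f g : C(UnitAddCircle, ℝ)) :
    ∫ v : UnitAddCircle, (a * (f - g)) v =
      (∫ v : UnitAddCircle, (a * f) v) - ∫ v : UnitAddCircle, (a * g) v := by
  rw [← MeasureTheory.integral_sub (integrable_continuousMap (a * f))
    (integrable_continuousMap (a * g))]
  simp [mul_sub]

theorem outRate_sub (g h : Profile K) (k : Fin (K + 1)) (u : UnitAddCircle) :
    outRate φ (g - h) k u = outRate φ g k u - outRate φ h k u := by
  simp only [outRate_eq, Pi.sub_apply, integral_mul_sub, Finset.sum_sub_distrib]

theorem inRate_sub (g h : Profile K) (k : Fin (K + 1)) (u : UnitAddCircle) :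
    inRate φ (g - h) k u = inRate φ g k u - inRate φ h k u := by
  simp only [inRate_eq, Pi.sub_apply, integral_mul_sub, Finset.sum_sub_distrib]

theorem abs_integral_le (f : C(UnitAddCircle, ℝ)) {C : ℝ} (h : ∀ u, |f u| ≤ C) :
    |∫ v : UnitAddCircle, f v| ≤ C := by
  simpa [MeasureTheory.measureReal_def, UnitAddCircle.measure_univ] using
    MeasureTheory.norm_integral_le_of_norm_le_const (μ := MeasureTheory.volume)
    (f := fun v => f v) (Filter.Eventually.of_forall fun v => h v)

theorem abs_apply_le (g : Profile K) (k : Fin (K + 1)) (u : UnitAddCircle) : |g k u| ≤ ‖g‖ :=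
  ((g k).norm_coe_le_norm u).trans (norm_le_pi_norm g k)

theorem abs_sum_integral_mul_le (a g : Profile K) {C : ℝ} (ha : ∀ l v, |a l v| ≤ C) :
    |∑ l, ∫ v : UnitAddCircle, (a l * g l) v| ≤ (K + 1) * C * ‖g‖ := by
  refine (Finset.abs_sum_le_sum_abs _ _).trans ((Finset.sum_le_card_nsmul _ _ (C * ‖g‖)
    fun l _ => abs_integral_le _ fun v => ?_).trans_eq ?_)
  · rw [ContinuousMap.mul_apply, abs_mul]
    exact mul_le_mul (ha l v) (abs_apply_le g l v) (abs_nonneg _) ((abs_nonneg _).trans (ha l v))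
  · simp; ring

theorem abs_outRate_le (g : Profile K) (k : Fin (K + 1)) (u : UnitAddCircle) :
    |outRate φ g k u| ≤ (K + 1) * φ.bound * ‖g‖ :=
  abs_sum_integral_mul_le (fun l => φ.outKernel k l u) g fun l v => φ.abs_le_bound k l u v

theorem abs_inRate_le (g : Profile K) (k : Fin (K + 1)) (u : UnitAddCircle) :
    |inRate φ g k u| ≤ (K + 1) * φ.bound * ‖g‖ := by
  rw [inRate_eq]
  exact abs_sum_integral_mul_le (fun l => φ.inKernel k l u) g fun l v => φ.abs_le_bound l k v u

theorem outRate_nonneg {g : Profile K} (hg : ∀ k u, 0 ≤ g k u) (k : Fin (K + 1))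
    (u : UnitAddCircle) : 0 ≤ outRate φ g k u :=
  Finset.sum_nonneg fun _ _ => MeasureTheory.integral_nonneg fun v =>
    mul_nonneg (φ.nonneg k _ u v) (hg _ v)

theorem inRate_nonneg {g : Profile K} (hg : ∀ k u, 0 ≤ g k u) (k : Fin (K + 1))
    (u : UnitAddCircle) : 0 ≤ inRate φ g k u :=
  Finset.sum_nonneg fun _ _ => MeasureTheory.integral_nonneg fun v =>
    mul_nonneg (φ.nonneg _ k v u) (hg _ v)

/-- The drift, at the position `u` and level `m` and in the environment `h`, of the
observable `a` of the level. -/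
def levelDrift (h : Profile K) (a : Fin (K + 1) → ℝ) (m : Fin (K + 1)) (u : UnitAddCircle) : ℝ :=
  (a (lower m) - a m) * outRate φ h m u + (a (raise m) - a m) * inRate φ h m u

/-- The three cases merge because nothing leaves an empty position and nothing enters a full one;
only the gain terms still need a case distinction. -/
theorem meanFieldRHS_eq (hK : 1 ≤ K) (g : Profile K) (k : Fin (K + 1)) (u : UnitAddCircle) :
    meanFieldRHS φ g k u =
      -(g k u * outRate φ g k u) - g k u * inRate φ g k u
        + (if k = 0 then 0 else g (lower k) u * inRate φ g (lower k) u)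
        + (if k = Fin.last K then 0 else g (raise k) u * outRate φ g (raise k) u) := by
  have hsub : k ≠ 0 → k - 1 = lower k := fun h => by
    have hk : (k : ℕ) ≠ 0 := fun h' => h (Fin.ext h')
    ext
    have h1 : ((1 : Fin (K + 1)) : ℕ) = 1 := by
      rw [Fin.val_one', Nat.mod_eq_of_lt (by omega)]
    rw [Fin.sub_val_of_le (by rw [Fin.le_def, h1]; omega), h1]
    rfl
  have hadd : k ≠ Fin.last K → k + 1 = raise k := fun h => by
    ext
    have hk : (k : ℕ) < K := Fin.val_lt_last h
    rw [Fin.val_add_one_of_lt (Fin.lt_last_iff_ne_last.2 h)]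
    simp only [raise]
    omega
  have h0 : (0 : Fin (K + 1)) ≠ Fin.last K := by
    rw [Ne, Fin.ext_iff]; simp; omega
  unfold meanFieldRHS
  by_cases hk0 : k = 0
  · subst hk0
    rw [if_pos rfl, if_pos rfl, if_neg h0, hadd h0, outRate_zero]
    ring
  · by_cases hkK : k = Fin.last K
    · rw [if_neg hk0, if_pos hkK, if_neg hk0, if_pos hkK, hsub hk0]
      rw [show inRate φ g k u = 0 by rw [hkK]; exact inRate_last φ g u]
      ring
    · rw [if_neg hk0, if_neg hkK, if_neg hk0, if_neg hkK, hsub hk0, hadd hkK]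
      ring

/-- Summation by parts over the levels: each gain term is reindexed by the level that it comes from,
and the missing boundary terms vanish. This duality gives mass conservation for `a = 1`, and later
matches the derivative of the profile with the generator. -/
theorem sum_mul_meanFieldRHS (hK : 1 ≤ K) (g : Profile K) (a : Fin (K + 1) → ℝ)
    (u : UnitAddCircle) :
    ∑ k, a k * meanFieldRHS φ g k u = ∑ m, g m u * levelDrift φ g a m u := by
  have h1 : ∑ k, a k * (if k = 0 then 0 else g (lower k) u * inRate φ g (lower k) u) =
      ∑ m, a (raise m) * (g m u * inRate φ g m u) := by
    rw [Fin.sum_univ_succ, Fin.sum_univ_castSucc]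
    simp [Fin.succ_ne_zero, lower_succ, raise_castSucc, inRate_last]
  have h2 : ∑ k, a k * (if k = Fin.last K then 0 else g (raise k) u * outRate φ g (raise k) u) =
      ∑ m, a (lower m) * (g m u * outRate φ g m u) := by
    rw [Fin.sum_univ_castSucc, Fin.sum_univ_succ]
    simp [Fin.castSucc_ne_last, lower_succ, raise_castSucc, outRate_zero]
  simp only [meanFieldRHS_eq φ hK, mul_add, Finset.sum_add_distrib, h1, h2]
  simp only [← Finset.sum_add_distrib, levelDrift]
  exact Finset.sum_congr rfl fun m _ => by ring

theorem sum_meanFieldRHS (hK : 1 ≤ K) (g : Profile K) (u : UnitAddCircle) :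
    ∑ k, meanFieldRHS φ g k u = 0 := by
  simpa [levelDrift] using sum_mul_meanFieldRHS φ hK g 1 u

theorem meanFieldRHS_eq_sum (hK : 1 ≤ K) (g : Profile K) (k : Fin (K + 1)) (u : UnitAddCircle) :
    meanFieldRHS φ g k u = ∑ m, g m u * levelDrift φ g (Pi.single k 1) m u := by
  rw [← sum_mul_meanFieldRHS φ hK]
  simp [Pi.single_apply]

theorem continuous_levelDrift (h : Profile K) (a : Fin (K + 1) → ℝ) (m : Fin (K + 1)) :
    Continuous (levelDrift φ h a m) :=
  (continuous_const.mul (continuous_outRate φ h m)).add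
    (continuous_const.mul (continuous_inRate φ h m))

theorem levelDrift_sub (g h : Profile K) (a : Fin (K + 1) → ℝ) (m : Fin (K + 1))
    (u : UnitAddCircle) :
    levelDrift φ (g - h) a m u = levelDrift φ g a m u - levelDrift φ h a m u := by
  simp only [levelDrift, outRate_sub, inRate_sub]
  ring

theorem abs_levelDrift_le (h : Profile K) {a : Fin (K + 1) → ℝ} (ha : ∀ m, |a m| ≤ 1)
    (m : Fin (K + 1)) (u : UnitAddCircle) :
    |levelDrift φ h a m u| ≤ 4 * ((K + 1) * φ.bound * ‖h‖) := by
  have h1 : ∀ m', |a m' - a m| ≤ 2 := fun m' =>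
    (abs_sub _ _).trans (by linarith [ha m', ha m])
  refine (abs_add_le _ _).trans ?_
  rw [abs_mul, abs_mul]
  have h2 := mul_le_mul (h1 (lower m)) (abs_outRate_le φ h m u) (abs_nonneg _) zero_le_two
  have h3 := mul_le_mul (h1 (raise m)) (abs_inRate_le φ h m u) (abs_nonneg _) zero_le_two
  linarith

/-- The right-hand side of the mean-field equation as a vector field. -/
def field (hK : 1 ≤ K) (g : Profile K) : Profile K := fun k =>
  ⟨meanFieldRHS φ g k, by
    simp only [funext (meanFieldRHS_eq_sum φ hK g k)]
    exact continuous_finsetSum _ fun m _ =>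
      (g m).continuous.mul (continuous_levelDrift φ _ _ m)⟩

@[simp]
theorem field_apply (hK : 1 ≤ K) (g : Profile K) (k : Fin (K + 1)) (u : UnitAddCircle) :
    field φ hK g k u = meanFieldRHS φ g k u := rfl

theorem abs_single_one_le (k m : Fin (K + 1)) : |(Pi.single k 1 : Fin (K + 1) → ℝ) m| ≤ 1 := by
  rw [Pi.single_apply]; split_ifs <;> simp

theorem profile_norm_le (g : Profile K) {C : ℝ} (hC : 0 ≤ C) (h : ∀ k u, |g k u| ≤ C) :
    ‖g‖ ≤ C :=
  (pi_norm_le_iff_of_nonneg hC).2 fun k => ((g k).norm_le hC).2 (h k)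

theorem norm_field_le (hK : 1 ≤ K) (g : Profile K) :
    ‖field φ hK g‖ ≤ 4 * (K + 1) ^ 2 * φ.bound * ‖g‖ ^ 2 := by
  have hR := φ.one_le_bound
  refine profile_norm_le _ (by positivity) fun k u => ?_
  rw [field_apply, meanFieldRHS_eq_sum φ hK]
  refine (Finset.abs_sum_le_sum_abs _ _).trans ((Finset.sum_le_card_nsmul _ _
    (‖g‖ * (4 * ((K + 1) * φ.bound * ‖g‖))) fun m _ => ?_).trans_eq ?_)
  · rw [abs_mul]
    exact mul_le_mul (abs_apply_le g m u) (abs_levelDrift_le φ g (abs_single_one_le k) m u)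
      (abs_nonneg _) (norm_nonneg _)
  · simp; ring

theorem norm_field_sub_le (hK : 1 ≤ K) (g h : Profile K) {M : ℝ} (hg : ‖g‖ ≤ M) (hh : ‖h‖ ≤ M) :
    ‖field φ hK g - field φ hK h‖ ≤ 8 * (K + 1) ^ 2 * φ.bound * M * ‖g - h‖ := by
  have hR := φ.one_le_bound
  have hM : 0 ≤ M := (norm_nonneg g).trans hg
  refine profile_norm_le _ (by positivity) fun k u => ?_
  rw [Pi.sub_apply, ContinuousMap.sub_apply, field_apply, field_apply, meanFieldRHS_eq_sum φ hK,
    meanFieldRHS_eq_sum φ hK, ← Finset.sum_sub_distrib]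
  refine (Finset.abs_sum_le_sum_abs _ _).trans ((Finset.sum_le_card_nsmul _ _
    (‖g - h‖ * (4 * ((K + 1) * φ.bound * M)) + M * (4 * ((K + 1) * φ.bound * ‖g - h‖)))
    fun m _ => ?_).trans_eq ?_)
  -- The field is bilinear in the profile and the environment, so one factor is changed at a time.
  · have e : g m u * levelDrift φ g (Pi.single k 1) m u
        - h m u * levelDrift φ h (Pi.single k 1) m u
        = (g - h) m u * levelDrift φ g (Pi.single k 1) m u
          + h m u * levelDrift φ (g - h) (Pi.single k 1) m u := by
      rw [levelDrift_sub, Pi.sub_apply, ContinuousMap.sub_apply]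
      ring
    rw [e]
    refine (abs_add_le _ _).trans ?_
    rw [abs_mul, abs_mul]
    refine add_le_add ?_ ?_
    · refine mul_le_mul (abs_apply_le (g - h) m u)
        ((abs_levelDrift_le φ g (abs_single_one_le k) m u).trans ?_)
        (abs_nonneg _) (norm_nonneg _)
      gcongr
    · exact mul_le_mul ((abs_apply_le h m u).trans hh)
        (abs_levelDrift_le φ (g - h) (abs_single_one_le k) m u) (abs_nonneg _) hM
  · simp; ring

theorem lipschitzOnWith_field (hK : 1 ≤ K) {M : ℝ} (hM : 0 ≤ M) :
    LipschitzOnWith (8 * (K + 1) ^ 2 * φ.bound * M).toNNReal (field φ hK)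
      {g | ‖g‖ ≤ M} := by
  have hR := φ.one_le_bound
  refine LipschitzOnWith.of_dist_le_mul fun g hg h hh => ?_
  rw [Real.coe_toNNReal _ (by positivity), dist_eq_norm, dist_eq_norm]
  exact norm_field_sub_le φ hK g h hg hh

end Rates

/-! ### Tools for ordinary differential equations -/

/-- The barrier `-δ (1 + t)` cannot be crossed: where `x` touches it, `x` is negative, so its
derivative is at least `0` and exceeds the slope `-δ`. -/
theorem nonneg_of_deriv_nonneg_of_neg {x x' : ℝ → ℝ} {T : ℝ}
    (hd : ∀ t ∈ Set.Icc 0 T, HasDerivWithinAt x (x' t) (Set.Icc 0 T) t) (h0 : 0 ≤ x 0)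
    (hx : ∀ t ∈ Set.Icc 0 T, x t < 0 → 0 ≤ x' t) : ∀ t ∈ Set.Icc 0 T, 0 ≤ x t := by
  intro t ht
  refine le_of_forall_pos_lt_add fun ε hε => ?_
  have hT : 0 ≤ T := ht.1.trans ht.2
  have hc : ContinuousOn x (Set.Icc 0 T) := fun s hs => (hd s hs).continuousWithinAt
  -- With this choice the barrier stays strictly above `-ε` on `[0, T]`.
  set δ := ε / (T + 2)
  have hδ : 0 < δ := by positivity
  have key := image_le_of_deriv_right_lt_deriv_boundary' (f := fun s => -x s)
    (f' := fun s => -x' s) (B := fun s => δ * (1 + s)) (B' := fun _ => δ) (a := 0) (b := T)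
    hc.neg
    (fun s hs => ((hd s ⟨hs.1, hs.2.le⟩).mono_of_mem_nhdsWithin
      (Filter.mem_of_superset (Icc_mem_nhdsGE_of_mem hs) subset_rfl)).neg)
    (by simp; linarith) (by fun_prop)
    (fun s _ => by
      simpa using (((hasDerivAt_id s).const_add 1).const_mul δ).hasDerivWithinAt)
    (fun s hs he => by
      have : x s < 0 := by
        have h1 : 0 < δ * (1 + s) := mul_pos hδ (by linarith [hs.1])
        linarith
      linarith [hx s ⟨hs.1, hs.2.le⟩ this]) ht
  have h2 : δ * (1 + t) < ε := by
    have : δ * (T + 2) = ε := by simp only [δ]; field_simp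
    nlinarith [ht.2]
  linarith [key]

/-- A field bounded by `L` cannot leave the ball of radius `L * T` before time `T`, so the length of
the interval is not restricted. -/
theorem exists_solution_Icc {E : Type*} [NormedAddCommGroup E] [NormedSpace ℝ E] [CompleteSpace E]
    {v : E → E} {L k : ℝ≥0} (hv : LipschitzWith k v) (hL : ∀ x, ‖v x‖ ≤ L) (x₀ : E) {T : ℝ}
    (hT : 0 ≤ T) :
    ∃ α : ℝ → E, α 0 = x₀ ∧
      ∀ t ∈ Set.Icc 0 T, HasDerivWithinAt α (v (α t)) (Set.Icc 0 T) t := by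
  have h : IsPicardLindelof (fun _ => v) (⟨0, le_rfl, hT⟩ : Set.Icc 0 T) x₀
      (L * T.toNNReal) 0 L k :=
    { lipschitzOnWith := fun _ _ => hv.lipschitzOnWith
      continuousOn := fun _ _ => continuousOn_const
      norm_le := fun _ _ x _ => hL x
      mul_max_le := by simp [hT] }
  simpa using h.exists_eq_forall_mem_Icc_hasDerivWithinAt₀

theorem HasDerivWithinAt.Ici_of_Icc {E : Type*} [NormedAddCommGroup E] [NormedSpace ℝ E]
    {f : ℝ → E} {f' : E} {T t : ℝ} (h : HasDerivWithinAt f f' (Set.Icc 0 T) t)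
    (ht : t < T) : HasDerivWithinAt f f' (Set.Ici 0) t := by
  refine h.mono_of_mem_nhdsWithin ?_
  rw [← Set.Ici_inter_Iic]
  exact Filter.inter_mem self_mem_nhdsWithin (mem_nhdsWithin_of_mem_nhds (Iic_mem_nhds ht))

/-- A profile of probability vectors. -/
def IsStochastic {K : ℕ} (g : Profile K) : Prop :=
  (∀ k u, 0 ≤ g k u) ∧ ∀ u, ∑ k, g k u = 1

theorem IsStochastic.le_one {K : ℕ} {g : Profile K} (h : IsStochastic g) (k : Fin (K + 1))
    (u : UnitAddCircle) : g k u ≤ 1 :=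
   (Finset.single_le_sum (f := fun k => g k u) (fun k _ => h.1 k u)
    (Finset.mem_univ k)).trans_eq (h.2 u)

/-- Pointwise truncation to `[0, 1]`. -/
def clip {K : ℕ} (g : Profile K) : Profile K := fun k =>
  ⟨fun u => max (min (g k u) 1) 0, by fun_prop⟩

@[simp]
theorem clip_apply {K : ℕ} (g : Profile K) (k : Fin (K + 1)) (u : UnitAddCircle) :
    clip g k u = max (min (g k u) 1) 0 := rfl

theorem clip_nonneg {K : ℕ} (g : Profile K) (k : Fin (K + 1)) (u : UnitAddCircle) :
    0 ≤ clip g k u := le_max_right _ _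

theorem norm_clip_le {K : ℕ} (g : Profile K) : ‖clip g‖ ≤ 1 :=
  profile_norm_le _ zero_le_one fun k u => by
    rw [abs_of_nonneg (clip_nonneg g k u)]
    simp

theorem norm_clip_sub_le {K : ℕ} (g h : Profile K) : ‖clip g - clip h‖ ≤ ‖g - h‖ :=
  profile_norm_le _ (norm_nonneg _) fun k u => by
    rw [Pi.sub_apply, ContinuousMap.sub_apply, clip_apply, clip_apply]
    refine (abs_max_sub_max_le_abs _ _ _).trans ((abs_min_sub_min_le_max _ _ _ _).trans ?_)
    simpa using abs_apply_le (g - h) k u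

theorem IsStochastic.clip_eq {K : ℕ} {g : Profile K} (h : IsStochastic g) : clip g = g := by
  ext k u
  simp [h.1 k u, h.le_one k u]

theorem IsStochastic.norm_le {K : ℕ} {g : Profile K} (h : IsStochastic g) : ‖g‖ ≤ 1 :=
  h.clip_eq ▸ norm_clip_le g

/-! ### Existence and uniqueness for the mean-field equation -/

section Equation

variable {K : ℕ} (φ : JumpRates K)

theorem hasDerivWithinAt_eval {α : ℝ → Profile K} {D : Profile K} {s : Set ℝ} {t : ℝ}
    (h : HasDerivWithinAt α D s t) (k : Fin (K + 1)) (u : UnitAddCircle) :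
    HasDerivWithinAt (fun s => α s k u) (D k u) s t :=
  (ContinuousMap.evalCLM (M := ℝ) ℝ u).hasFDerivAt.comp_hasDerivWithinAt (f := fun s => α s k) t
    (hasDerivWithinAt_pi.1 h k)

/-- A negative component is truncated to `0`, which removes its loss terms and leaves nonnegative
gains. The sum of the components is constant, since the field sums to `0` at every profile. -/
theorem isStochastic_of_clipped (hK : 1 ≤ K) {α : ℝ → Profile K} {T : ℝ}
    (h0 : IsStochastic (α 0))
    (hα : ∀ t ∈ Set.Icc 0 T,
      HasDerivWithinAt α (field φ hK (clip (α t))) (Set.Icc 0 T) t) :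
    ∀ t ∈ Set.Icc 0 T, IsStochastic (α t) := by
  intro t ht
  refine ⟨fun k u => ?_, fun u => ?_⟩
  · refine nonneg_of_deriv_nonneg_of_neg (fun s hs => hasDerivWithinAt_eval (hα s hs) k u)
      (h0.1 k u) (fun s _ hneg => ?_) t ht
    have hz : clip (α s) k u = 0 := by
      rw [clip_apply]
      exact max_eq_right ((min_le_left _ _).trans hneg.le)
    have hi := inRate_nonneg φ (clip_nonneg (α s))
    have ho := outRate_nonneg φ (clip_nonneg (α s))
    rw [field_apply, meanFieldRHS_eq φ hK, hz]
    have h1 : 0 ≤ if k = 0 then 0 else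
        clip (α s) (lower k) u * inRate φ (clip (α s)) (lower k) u := by
      split_ifs
      exacts [le_rfl, mul_nonneg (clip_nonneg _ _ _) (hi _ _)]
    have h2 : 0 ≤ if k = Fin.last K then 0 else
        clip (α s) (raise k) u * outRate φ (clip (α s)) (raise k) u := by
      split_ifs
      exacts [le_rfl, mul_nonneg (clip_nonneg _ _ _) (ho _ _)]
    linarith
  · have hd : ∀ s ∈ Set.Icc 0 T,
        HasDerivWithinAt (fun s => ∑ k, α s k u) 0 (Set.Icc 0 T) s := fun s hs => by
      have := HasDerivWithinAt.fun_sum (u := Finset.univ)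
        fun k _ => hasDerivWithinAt_eval (hα s hs) k u
      simpa [sum_meanFieldRHS φ hK] using this
    have := constant_of_has_deriv_right_zero (fun s hs => (hd s hs).continuousWithinAt)
      (fun s hs => (hd s ⟨hs.1, hs.2.le⟩).mono_of_mem_nhdsWithin (Icc_mem_nhdsGE_of_mem hs)) t ht
    rw [this]
    exact h0.2 u

theorem exists_stochastic_solution_Icc (hK : 1 ≤ K) {ρ₀ : Profile K} (h0 : IsStochastic ρ₀)
    {T : ℝ} (hT : 0 ≤ T) :
    ∃ α : ℝ → Profile K, α 0 = ρ₀ ∧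
      (∀ t ∈ Set.Icc 0 T, HasDerivWithinAt α (field φ hK (α t)) (Set.Icc 0 T) t) ∧
      ∀ t ∈ Set.Icc 0 T, IsStochastic (α t) := by
  have hR := φ.one_le_bound
  have hlip : LipschitzWith (8 * (K + 1) ^ 2 * φ.bound).toNNReal
      (fun g : Profile K => field φ hK (clip g)) :=
    LipschitzWith.of_dist_le_mul fun g h => by
      rw [Real.coe_toNNReal _ (by positivity), dist_eq_norm, dist_eq_norm]
      refine (norm_field_sub_le φ hK _ _ (norm_clip_le g) (norm_clip_le h)).trans ?_
      rw [mul_one]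
      gcongr
      exact norm_clip_sub_le g h
  have hbound : ∀ g : Profile K,
      ‖field φ hK (clip g)‖ ≤ (4 * (K + 1) ^ 2 * φ.bound).toNNReal := fun g => by
    rw [Real.coe_toNNReal _ (by positivity)]
    refine (norm_field_le φ hK _).trans (mul_le_of_le_one_right (by positivity) ?_)
    exact pow_le_one₀ (norm_nonneg _) (norm_clip_le g)
  obtain ⟨α, hα0, hα⟩ := exists_solution_Icc hlip hbound ρ₀ hT
  have hs := isStochastic_of_clipped φ hK (hα0 ▸ h0) hα
  refine ⟨α, hα0, fun t ht => ?_, hs⟩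
  simpa only [(hs t ht).clip_eq] using hα t ht

/-- Neither solution is assumed stochastic. By continuity both stay in a common ball on `[0, T]`,
where the field is Lipschitz. -/
theorem eqOn_of_solutions (hK : 1 ≤ K) {α β : ℝ → Profile K} {T : ℝ}
    (hα : ∀ t ∈ Set.Icc 0 T, HasDerivWithinAt α (field φ hK (α t)) (Set.Icc 0 T) t)
    (hβ : ∀ t ∈ Set.Icc 0 T, HasDerivWithinAt β (field φ hK (β t)) (Set.Icc 0 T) t)
    (h0 : α 0 = β 0) : Set.EqOn α β (Set.Icc 0 T) := by
  have hαc : ContinuousOn α (Set.Icc 0 T) := fun t ht => (hα t ht).continuousWithinAt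
  have hβc : ContinuousOn β (Set.Icc 0 T) := fun t ht => (hβ t ht).continuousWithinAt
  obtain ⟨A, hA⟩ := isCompact_Icc.exists_bound_of_continuousOn hαc
  obtain ⟨B, hB⟩ := isCompact_Icc.exists_bound_of_continuousOn hβc
  refine ODE_solution_unique_of_mem_Icc_right (v := fun _ => field φ hK)
    (s := fun _ => {g | ‖g‖ ≤ max 0 (max A B)})
    (fun _ _ => lipschitzOnWith_field φ hK (le_max_left _ _)) hαc
    (fun t ht => (hα t ⟨ht.1, ht.2.le⟩).mono_of_mem_nhdsWithin (Icc_mem_nhdsGE_of_mem ht))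
    (fun t ht => (hA t ⟨ht.1, ht.2.le⟩).trans ((le_max_left A B).trans (le_max_right _ _))) hβc
    (fun t ht => (hβ t ⟨ht.1, ht.2.le⟩).mono_of_mem_nhdsWithin (Icc_mem_nhdsGE_of_mem ht))
    (fun t ht => (hB t ⟨ht.1, ht.2.le⟩).trans ((le_max_right A B).trans (le_max_right _ _))) h0

theorem exists_stochastic_solution (hK : 1 ≤ K) {ρ₀ : Profile K} (h0 : IsStochastic ρ₀) :
    ∃ α : ℝ → Profile K, α 0 = ρ₀ ∧
      (∀ t, 0 ≤ t → HasDerivWithinAt α (field φ hK (α t)) (Set.Ici 0) t) ∧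
      ∀ t, 0 ≤ t → IsStochastic (α t) := by
  choose! α hα0 hα hs using fun (T : ℝ) (hT : 0 ≤ T) =>
    exists_stochastic_solution_Icc φ hK h0 hT
  have heq : ∀ S T t, 0 ≤ t → t ≤ S → S ≤ T → α S t = α T t := fun S T t h0t htS hST =>
    eqOn_of_solutions φ hK (hα S (h0t.trans htS))
      (fun s hs => (hα T (h0t.trans (htS.trans hST)) s ⟨hs.1, hs.2.trans hST⟩).mono
        (Set.Icc_subset_Icc_right hST))
      ((hα0 S (h0t.trans htS)).trans (hα0 T (h0t.trans (htS.trans hST))).symm) ⟨h0t, htS⟩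
  -- The value at `t` is read off the solution on `[0, t + 1]`, so that `t` is not a right endpoint.
  -- For `s` near `t` the horizon `s + 1` stays below `t + 2`, and everything is compared with the
  -- solution on `[0, t + 2]`.
  refine ⟨fun t => α (t + 1) t, ?_, fun t ht => ?_, fun t ht => ?_⟩
  · simpa using hα0 (0 + 1) (by norm_num)
  · have h1 : HasDerivWithinAt (α (t + 2)) (field φ hK (α (t + 2) t)) (Set.Ici 0) t :=
      HasDerivWithinAt.Ici_of_Icc (hα (t + 2) (by linarith) t ⟨ht, by linarith⟩) (by linarith)
    rw [← heq (t + 1) (t + 2) t ht (by linarith) (by linarith)] at h1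
    refine h1.congr_of_eventuallyEq ?_ (heq (t + 1) (t + 2) t ht (by linarith) (by linarith))
    filter_upwards [self_mem_nhdsWithin,
      mem_nhdsWithin_of_mem_nhds (Iic_mem_nhds (show t < t + 1 by linarith))] with s hs hst
    have hst' : s ≤ t + 1 := hst
    exact heq (s + 1) (t + 2) s hs (by linarith) (by linarith)
  · exact hs (t + 1) (by linarith) t ⟨ht, by linarith⟩

theorem IsMeanFieldSolution.hasDerivWithinAt_field (hK : 1 ≤ K) {ψ : UnitAddCircle → ℝ}
    {ρ : ℝ≥0 → Fin (K + 1) → C(UnitAddCircle, ℝ)} (h : IsMeanFieldSolution φ ψ ρ) {t : ℝ}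
    (ht : 0 ≤ t) :
    HasDerivWithinAt (fun s : ℝ => ρ s.toNNReal) (field φ hK (ρ t.toNNReal)) (Set.Ici 0) t := by
  obtain ⟨D, hD, hDe⟩ := h.hasDeriv t.toNNReal
  rw [Real.coe_toNNReal t ht] at hD
  convert hD using 1
  ext k u
  exact (hDe k u).symm

theorem IsMeanFieldSolution.unique (hK : 1 ≤ K) {ψ : UnitAddCircle → ℝ}
    {ρ ρ' : ℝ≥0 → Fin (K + 1) → C(UnitAddCircle, ℝ)} (h : IsMeanFieldSolution φ ψ ρ)
    (h' : IsMeanFieldSolution φ ψ ρ') : ρ = ρ' := by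
  funext t
  have := eqOn_of_solutions φ hK (T := t)
    (fun s hs => (h.hasDerivWithinAt_field φ hK hs.1).mono Set.Icc_subset_Ici_self)
    (fun s hs => (h'.hasDerivWithinAt_field φ hK hs.1).mono Set.Icc_subset_Ici_self)
    (by
      ext k u
      simp [h.initial, h'.initial])
    ⟨t.2, le_rfl⟩
  simpa using this

theorem binomialMass_nonneg {p : ℝ} (h0 : 0 ≤ p) (h1 : p ≤ 1) (k : Fin (K + 1)) :
    0 ≤ binomialMass K p k := by
  have : 0 ≤ 1 - p := by linarith
  unfold binomialMass
  positivity

theorem sum_binomialMass (p : ℝ) : ∑ k, binomialMass K p k = 1 := by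
  have := add_pow p (1 - p) K
  rw [add_sub_cancel, one_pow, Finset.sum_range] at this
  rw [this]
  exact Finset.sum_congr rfl fun k _ => by rw [binomialMass]; ring

theorem exists_isMeanFieldSolution (hK : 1 ≤ K) {ψ : UnitAddCircle → ℝ}
    (hψ : ψ ∈ admissibleProfiles K) :
    ∃ ρ : ℝ≥0 → Fin (K + 1) → C(UnitAddCircle, ℝ), IsMeanFieldSolution φ ψ ρ ∧
      ∀ t, IsStochastic (ρ t) := by
  have hK' : (0 : ℝ) < K := by exact_mod_cast hK
  have hc := hψ.1.continuous
  let ρ₀ : Profile K := fun k => ⟨fun u => binomialMass K (ψ u / K) k, by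
    unfold binomialMass; fun_prop⟩
  have h0 : IsStochastic ρ₀ :=
    ⟨fun k u => binomialMass_nonneg (div_nonneg (hψ.2 u).1.le hK'.le)
      ((div_le_one hK').2 (hψ.2 u).2.le) k, fun u => sum_binomialMass _⟩
  obtain ⟨α, hα0, hα, hs⟩ := exists_stochastic_solution φ hK h0
  refine ⟨fun t => α t, ⟨fun k u => ?_, fun t => ⟨field φ hK (α t), ?_, fun k u => rfl⟩⟩,
    fun t => hs t t.2⟩
  · simp [hα0, ρ₀]
  · refine (hα t t.2).congr (fun s hs => ?_) ?_
    · simp [Real.coe_toNNReal s hs]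
    · simp

end Equation

/-! ### Riemann sums -/

/-- The Riemann sum of `h` at the `N` macroscopic positions. -/
def riemannSum (N : ℕ) (h : C(UnitAddCircle, ℝ)) : ℝ := (1 / (N : ℝ)) * ∑ i, h (site N i)

theorem abs_average_le {N : ℕ} (a : Fin N → ℝ) {C : ℝ} (hC : 0 ≤ C) (h : ∀ i, |a i| ≤ C) :
    |(1 / (N : ℝ)) * ∑ i, a i| ≤ C := by
  rw [abs_mul, abs_of_nonneg (by positivity)]
  -- For `N = 0` the average is `0`, because `1 / 0 = 0`.
  rcases N.eq_zero_or_pos with rfl | hN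
  · simpa using hC
  have hN' : (0 : ℝ) < N := by exact_mod_cast hN
  have : |∑ i, a i| ≤ N * C := (Finset.abs_sum_le_sum_abs _ _).trans
    ((Finset.sum_le_card_nsmul _ _ C fun i _ => h i).trans_eq (by simp))
  calc 1 / (N : ℝ) * |∑ i, a i| ≤ 1 / (N : ℝ) * (N * C) := by gcongr
    _ = C := by field_simp

theorem average_mono {N : ℕ} {a b : Fin N → ℝ} (h : ∀ i, a i ≤ b i) :
    (1 / (N : ℝ)) * ∑ i, a i ≤ (1 / (N : ℝ)) * ∑ i, b i :=
  mul_le_mul_of_nonneg_left (Finset.sum_le_sum fun i _ => h i) (by positivity)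

theorem average_le {N : ℕ} {a : Fin N → ℝ} {C : ℝ} (hC : 0 ≤ C) (h : ∀ i, a i ≤ C) :
    (1 / (N : ℝ)) * ∑ i, a i ≤ C := by
  refine (average_mono h).trans ((le_abs_self _).trans ?_)
  exact abs_average_le _ hC fun _ => (abs_of_nonneg hC).le

theorem tendsto_riemannSum (h : C(UnitAddCircle, ℝ)) :
    Filter.Tendsto (fun N => riemannSum N h) Filter.atTop (nhds (∫ u, h u)) := by
  have hc : Continuous fun x : ℝ => h (x : UnitAddCircle) :=
    h.continuous.comp (AddCircle.continuous_mk' 1)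
  have huc := isCompact_Icc.uniformContinuousOn_of_continuous
    (hc.continuousOn (s := Set.Icc (0 : ℝ) 1))
  rw [Metric.uniformContinuousOn_iff] at huc
  rw [Metric.tendsto_atTop]
  intro ε hε
  obtain ⟨δ, hδ, H⟩ := huc (ε / 2) (by positivity)
  obtain ⟨n, hn⟩ := exists_nat_gt (1 / δ)
  refine ⟨n + 1, fun N hN => ?_⟩
  have hN0 : 0 < N := by omega
  have hN' : (0 : ℝ) < N := by exact_mod_cast hN0
  have hNδ : 1 / (N : ℝ) < δ := by
    rw [div_lt_comm₀ hN' hδ]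
    exact hn.trans (by exact_mod_cast hN)
  have hint : ∫ u, h u = ∑ i : Fin N,
      ∫ x in ((i : ℕ) : ℝ) / N..(((i : ℕ) + 1 : ℕ) : ℝ) / N, h (x : UnitAddCircle) := by
    have h1 := UnitAddCircle.intervalIntegral_preimage 0 h
    have h2 := intervalIntegral.sum_integral_adjacent_intervals
      (f := fun x : ℝ => h (x : UnitAddCircle)) (μ := MeasureTheory.volume)
      (a := fun k : ℕ => (k : ℝ) / N) (n := N) fun k _ => hc.intervalIntegrable _ _
    rw [Finset.sum_range] at h2
    simp only [Nat.cast_zero, zero_div, div_self hN'.ne'] at h2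
    rw [h2, ← h1, zero_add]
  -- Each site is the right endpoint of its cell of length `1/N`. The error becomes an average of
  -- cell means, each at most `ε / 2` by uniform continuity.
  have hsum : riemannSum N h - ∫ u, h u = (1 / (N : ℝ)) * ∑ i : Fin N,
      ((N : ℝ) * ∫ x in ((i : ℕ) : ℝ) / N..(((i : ℕ) + 1 : ℕ) : ℝ) / N,
        (h (site N i) - h (x : UnitAddCircle))) := by
    rw [hint, riemannSum, ← Finset.mul_sum, ← mul_assoc, one_div_mul_cancel hN'.ne', one_mul,
      Finset.mul_sum, ← Finset.sum_sub_distrib]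
    refine Finset.sum_congr rfl fun i _ => ?_
    rw [intervalIntegral.integral_sub (by simp) (hc.intervalIntegrable _ _),
      intervalIntegral.integral_const, smul_eq_mul]
    congr 2
    push_cast
    ring
  rw [Real.dist_eq, hsum]
  refine (abs_average_le _ (C := ε / 2) (by positivity) fun i => ?_).trans_lt (by linarith)
  have hi1 : ((i : ℕ) : ℝ) + 1 ≤ N := by exact_mod_cast i.2
  have hle : ((i : ℕ) : ℝ) / N ≤ (((i : ℕ) + 1 : ℕ) : ℝ) / N := by
    gcongr
    simp
  have hb := intervalIntegral.norm_integral_le_of_norm_le_const (C := ε / 2)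
    (a := ((i : ℕ) : ℝ) / N) (b := (((i : ℕ) + 1 : ℕ) : ℝ) / N)
    (f := fun x : ℝ => h (site N i) - h (x : UnitAddCircle)) fun x hx => by
      rw [Set.uIoc_of_le hle] at hx
      push_cast at hx
      have h3 : (((i : ℕ) : ℝ) + 1) / N ≤ 1 := (div_le_one hN').2 hi1
      have h4 : 0 ≤ ((i : ℕ) : ℝ) / N := by positivity
      refine (H _ ⟨by positivity, h3⟩ x ⟨by linarith [hx.1], hx.2.trans h3⟩ ?_).le
      rw [Real.dist_eq, abs_of_nonneg (by linarith [hx.2])]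
      have : (((i : ℕ) : ℝ) + 1) / N = ((i : ℕ) : ℝ) / N + 1 / N := by ring
      linarith [hx.1]
  rw [abs_mul, abs_of_pos hN']
  rw [Real.norm_eq_abs] at hb
  refine (mul_le_mul_of_nonneg_left hb hN'.le).trans_eq ?_
  have : |(((i : ℕ) + 1 : ℕ) : ℝ) / N - ((i : ℕ) : ℝ) / N| = 1 / N := by
    rw [abs_of_nonneg (by linarith)]
    push_cast
    ring
  rw [this]
  field_simp

/-- Riemann sums and the integral are both `1`-Lipschitz in the supremum norm, so a finite `ε /
3`-net of the compact set suffices. -/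
theorem eventually_riemannSum_sub_le {S : Set C(UnitAddCircle, ℝ)} (hS : IsCompact S) {ε : ℝ}
    (hε : 0 < ε) :
    ∀ᶠ N in Filter.atTop, ∀ h ∈ S, |riemannSum N h - ∫ u, h u| ≤ ε := by
  obtain ⟨t, -, htf, hcov⟩ := hS.finite_cover_balls (show 0 < ε / 3 by positivity)
  have hev : ∀ᶠ N in Filter.atTop, ∀ h ∈ t, |riemannSum N h - ∫ u, h u| < ε / 3 :=
    (Filter.eventually_all_finite htf).2 fun h _ =>
      (Metric.tendsto_nhds.1 (tendsto_riemannSum h) (ε / 3) (by positivity))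
  filter_upwards [hev] with N hN h hh
  obtain ⟨g, hg, hhg⟩ := Set.mem_iUnion₂.1 (hcov hh)
  rw [Metric.mem_ball, dist_eq_norm] at hhg
  have hpt : ∀ u, |(h - g) u| ≤ ε / 3 := fun u => ((h - g).norm_coe_le_norm u).trans hhg.le
  have h1 : |riemannSum N h - riemannSum N g| ≤ ε / 3 := by
    rw [riemannSum, riemannSum, ← mul_sub, ← Finset.sum_sub_distrib]
    exact abs_average_le _ (by positivity) fun i => hpt _
  have h2 : |(∫ u, h u) - ∫ u, g u| ≤ ε / 3 := by
    rw [← MeasureTheory.integral_sub (integrable_continuousMap h) (integrable_continuousMap g)]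
    exact abs_integral_le (h - g) hpt
  have h3 := hN g hg
  rw [abs_le] at h1 h2 ⊢
  rw [abs_lt] at h3
  constructor <;> linarith [h1.1, h1.2, h2.1, h2.2, h3.1, h3.2]

/-! ### One-time laws of a finite Markov process -/

section MarkovProcess

/-- Passing to the restriction of `P` to `A` makes measurability of `A` unnecessary. -/
theorem sum_real_preimage {S Ω : Type*} [Fintype S] [MeasurableSpace Ω]
    {P : MeasureTheory.Measure Ω} [MeasureTheory.IsProbabilityMeasure P] {Z : Ω → S}
    (hZ : ∀ x, MeasurableSet {ω | Z ω = x}) {A : Set Ω} :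
    P.real A = ∑ x, P.real (A ∩ {ω | Z ω = x}) := by
  have h := MeasureTheory.measureReal_biUnion_finset (μ := P.restrict A) (s := Finset.univ)
    (f := fun x => {ω | Z ω = x})
    (fun x _ y _ hxy => Set.disjoint_left.2 fun ω h1 h2 => hxy (h1.symm.trans h2))
    (fun x _ => hZ x)
  have hu : ⋃ x ∈ (Finset.univ : Finset S), {ω | Z ω = x} = Set.univ := by
    ext ω; simp
  rw [hu] at h
  simp only [MeasureTheory.measureReal_def, MeasureTheory.Measure.restrict_apply (hZ _),
    MeasureTheory.Measure.restrict_apply MeasurableSet.univ, Set.univ_inter] at h ⊢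
  simpa only [Set.inter_comm] using h

variable {S Ω : Type*} [Fintype S] [DecidableEq S]

/-- A curve of probability vectors that solves the forward equation of `Q` on `[0, ∞)`. -/
structure IsForwardSolution (Q : Matrix S S ℝ) (p : ℝ → S → ℝ) : Prop where
  hasDerivAt : ∀ t x, HasDerivAt (fun s => p s x) (∑ y, p t y * Q y x) t
  nonneg : ∀ t, 0 ≤ t → ∀ x, 0 ≤ p t x
  sum_eq_one : ∀ t, 0 ≤ t → ∑ x, p t x = 1

theorem hasDerivAt_exp_smul_apply (Q : Matrix S S ℝ) (x y : S) (t : ℝ) :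
    HasDerivAt (fun s : ℝ => NormedSpace.exp (s • Q) x y)
      (∑ z, NormedSpace.exp (t • Q) x z * Q z y) t := by
  let _ : NormedRing (Matrix S S ℝ) := Matrix.linftyOpNormedRing
  let _ : NormedAlgebra ℝ (Matrix S S ℝ) := Matrix.linftyOpNormedAlgebra
  have h : HasDerivAt (fun s : ℝ => NormedSpace.exp (s • Q)) (NormedSpace.exp (t • Q) * Q) t :=
    hasDerivAt_exp_smul_const Q t
  let e : Matrix S S ℝ →L[ℝ] ℝ :=
    LinearMap.toContinuousLinearMap (Matrix.entryLinearMap ℝ ℝ x y)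
  exact e.hasFDerivAt.comp_hasDerivAt t h

variable [MeasurableSpace Ω] {Q : Matrix S S ℝ} {P : MeasureTheory.Measure Ω} {X : ℝ≥0 → Ω → S}

theorem IsMarkovProcess.real_eq [MeasureTheory.IsProbabilityMeasure P]
    (h : IsMarkovProcess Q P X) (t : ℝ≥0) (x : S) :
    P.real {ω | X t ω = x} =
      ∑ y, P.real {ω | X 0 ω = y} * NormedSpace.exp ((t : ℝ) • Q) y x := by
  rw [sum_real_preimage (h.measurable 0) (A := {ω | X t ω = x})]
  refine Finset.sum_congr rfl fun y _ => ?_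
  -- The Markov property is applied to the times `0, t, t, …` with one transition.
  have hm : Monotone fun n : ℕ => if n = 0 then (0 : ℝ≥0) else t := by
    refine monotone_nat_of_le_succ fun n => ?_
    by_cases hn : n = 0 <;> simp [hn]
  have := h.markov _ hm (fun n => if n = 0 then y else x) 0
  have e1 : {ω | ∀ i ≤ 0 + 1, X (if i = 0 then 0 else t) ω = if i = 0 then y else x} =
      {ω | X t ω = x} ∩ {ω | X 0 ω = y} := by
    ext ω
    constructor
    · intro H
      exact ⟨by simpa using H 1 le_rfl, by simpa using H 0 (by omega)⟩
    · rintro ⟨H1, H0⟩ i hi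
      by_cases hi0 : i = 0
      · simpa [hi0] using H0
      · simpa [hi0] using H1
  have e2 : {ω | ∀ i ≤ 0, X (if i = 0 then 0 else t) ω = if i = 0 then y else x} =
      {ω | X 0 ω = y} := by
    ext ω
    simp
  rw [e1, e2] at this
  simpa using this

/-- Nonnegativity and total mass `1` are inherited from the probabilities, so positivity of `exp (t
Q)` need not be proved. -/
theorem IsMarkovProcess.exists_forwardSolution [MeasureTheory.IsProbabilityMeasure P]
    (h : IsMarkovProcess Q P X) :
    ∃ p : ℝ → S → ℝ, IsForwardSolution Q p ∧ ∀ (t : ℝ≥0) x, p t x = P.real {ω | X t ω = x} := by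
  refine ⟨fun t x => ∑ y, P.real {ω | X 0 ω = y} * NormedSpace.exp (t • Q) y x, ⟨?_, ?_, ?_⟩,
    fun t x => (h.real_eq t x).symm⟩
  · intro t x
    refine (HasDerivAt.fun_sum fun y _ =>
      (hasDerivAt_exp_smul_apply Q y x t).const_mul _).congr_deriv ?_
    simp only [Finset.sum_mul, Finset.mul_sum]
    rw [Finset.sum_comm]
    exact Finset.sum_congr rfl fun z _ => Finset.sum_congr rfl fun y _ => by ring
  · intro t ht x
    lift t to ℝ≥0 using ht
    rw [← h.real_eq t x]
    positivity
  · intro t ht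
    lift t to ℝ≥0 using ht
    simp only [← h.real_eq t]
    have := sum_real_preimage (P := P) (h.measurable t) (A := Set.univ)
    simpa using this.symm

theorem integral_comp_eq_sum [MeasureTheory.IsProbabilityMeasure P] {Z : Ω → S}
    (hZ : ∀ x, MeasurableSet {ω | Z ω = x}) (F : S → ℝ) :
    MeasureTheory.MemLp (fun ω => F (Z ω)) 2 P ∧
      ∫ ω, F (Z ω) ^ 2 ∂P = ∑ x, P.real {ω | Z ω = x} * F x ^ 2 := by
  let _ : MeasurableSpace S := ⊤
  have hm : Measurable Z := measurable_to_countable' hZ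
  refine ⟨MeasureTheory.MemLp.of_bound (C := ∑ x, |F x|)
    ((measurable_from_top (f := F)).comp hm).aestronglyMeasurable
    (Filter.Eventually.of_forall fun ω => Finset.single_le_sum (f := fun x => |F x|)
      (fun _ _ => abs_nonneg _) (Finset.mem_univ (Z ω))), ?_⟩
  have e : ∀ ω, F (Z ω) ^ 2 = ∑ x, Set.indicator {ω | Z ω = x} (fun _ => F x ^ 2) ω := by
    intro ω
    simp [Set.indicator_apply]
  simp_rw [e]
  rw [MeasureTheory.integral_finsetSum _ fun x _ =>
    (MeasureTheory.integrable_const _).indicator (hZ x)]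
  refine Finset.sum_congr rfl fun x _ => ?_
  rw [MeasureTheory.integral_indicator_const _ (hZ x), smul_eq_mul]

/-- Dynkin's formula in expectation: exchanging the two sums moves `Q` from the law to the
observable. -/
theorem IsForwardSolution.hasDerivWithinAt_sum {S : Type*} [Fintype S] {Q : Matrix S S ℝ} {p : ℝ → S → ℝ}
    (hp : IsForwardSolution Q p)
    {F : ℝ → S → ℝ} {F' : S → ℝ} {s : Set ℝ} {t : ℝ}
    (hF : ∀ x, HasDerivWithinAt (fun r => F r x) (F' x) s t) :
    HasDerivWithinAt (fun r => ∑ x, p r x * F r x)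
      (∑ x, p t x * ((∑ y, Q x y * F t y) + F' x)) s t := by
  refine (HasDerivWithinAt.fun_sum fun x _ =>
    (hp.hasDerivAt t x).hasDerivWithinAt.mul (hF x)).congr_deriv ?_
  simp only [mul_add, Finset.sum_add_distrib, Finset.sum_mul, Finset.mul_sum]
  congr 1
  rw [Finset.sum_comm]
  exact Finset.sum_congr rfl fun x _ => Finset.sum_congr rfl fun y _ => by ring

end MarkovProcess

/-! ### The generator on averaged observables -/

section Generator

variable {K N : ℕ} (φ : JumpRates K)

theorem generator_eq (f : Config K N → ℝ) (η : Config K N) :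
    generator φ N f η = (1 / (N : ℝ)) * ∑ i : Fin N, ∑ j ∈ Finset.univ.erase i,
      φ.rate (η i) (η j) (site N i) (site N j) * (f (moveParticle η i j) - f η) := by
  unfold generator
  congr 1
  refine Finset.sum_congr rfl fun i _ => Finset.sum_congr rfl fun j _ => ?_
  rw [Finset.sum_eq_single (η i), Finset.sum_eq_single (η j)]
  · simp
  · intro l _ hl; simp [hl.symm]
  · simp
  · intro k _ hk; simp [hk.symm]
  · simp

theorem sum_generatorMatrix_mul (f : Config K N → ℝ) (η : Config K N) :
    ∑ ξ, generatorMatrix φ N η ξ * f ξ = generator φ N f η := by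
  simp only [generatorMatrix, Matrix.of_apply, generator_eq, Finset.mul_sum, Finset.sum_mul]
  rw [Finset.sum_comm]
  refine Finset.sum_congr rfl fun i _ => ?_
  rw [Finset.sum_comm]
  refine Finset.sum_congr rfl fun j _ => ?_
  have h : ∀ ζ : Config K N, ∑ ξ, (Pi.single ξ 1 : Config K N → ℝ) ζ * f ξ = f ζ := fun ζ => by
    simp [Pi.single_apply]
  have hsub : f (moveParticle η i j) - f η = ∑ ξ, ((Pi.single ξ 1 : Config K N → ℝ)
      (moveParticle η i j) * f ξ - (Pi.single ξ 1 : Config K N → ℝ) η * f ξ) := by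
    rw [Finset.sum_sub_distrib, h, h]
  rw [hsub, Finset.mul_sum, Finset.mul_sum]
  exact Finset.sum_congr rfl fun ξ _ => by ring

/-- The average over the positions of the observables `g i` of the local levels. -/
def testSum (g : Fin N → Fin (K + 1) → ℝ) (η : Config K N) : ℝ :=
  (1 / (N : ℝ)) * ∑ i, g i (η i)

theorem testSum_moveParticle (g : Fin N → Fin (K + 1) → ℝ) (η : Config K N) {i j : Fin N}
    (hij : i ≠ j) :
    testSum g (moveParticle η i j) - testSum g η = (1 / (N : ℝ)) *
      ((g i (lower (η i)) - g i (η i)) + (g j (raise (η j)) - g j (η j))) := by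
  rw [testSum, testSum, ← mul_sub, ← Finset.sum_sub_distrib]
  congr 1
  rw [Fintype.sum_eq_add i j hij]
  · simp [moveParticle, hij.symm, lower, raise]
  · rintro x ⟨hi, hj⟩
    simp [moveParticle, hi, hj]

theorem abs_sub_le_two {a : Fin (K + 1) → ℝ} (ha : ∀ k, |a k| ≤ 1) (k l : Fin (K + 1)) :
    |a k - a l| ≤ 2 :=
  (abs_sub _ _).trans (by linarith [ha k, ha l])

theorem abs_testSum_moveParticle_le {g : Fin N → Fin (K + 1) → ℝ} (hg : ∀ i k, |g i k| ≤ 1)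
    (η : Config K N) {i j : Fin N} (hij : i ≠ j) :
    |testSum g (moveParticle η i j) - testSum g η| ≤ 4 / N := by
  rw [testSum_moveParticle g η hij, abs_mul, abs_of_nonneg (by positivity : 0 ≤ 1 / (N : ℝ)),
    one_div_mul_eq_div]
  gcongr
  refine (abs_add_le _ _).trans ?_
  linarith [abs_sub_le_two (hg i) (lower (η i)) (η i), abs_sub_le_two (hg j) (raise (η j)) (η j)]

/-- The difference is the carré du champ. It has at most `N²` pairs, the prefactor `1/N`, rates at
most `φ.bound`, and squared jumps at most `(4/N)²`. -/
theorem abs_generator_sq_sub_le {g : Fin N → Fin (K + 1) → ℝ} (hg : ∀ i k, |g i k| ≤ 1) (c : ℝ)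
    (η : Config K N) :
    |generator φ N (fun ξ => (testSum g ξ - c) ^ 2) η
      - 2 * (testSum g η - c) * generator φ N (testSum g) η| ≤ 16 * φ.bound / N := by
  have hR := φ.one_le_bound
  have e : generator φ N (fun ξ => (testSum g ξ - c) ^ 2) η
      - 2 * (testSum g η - c) * generator φ N (testSum g) η =
      (1 / (N : ℝ)) * ∑ i : Fin N, ∑ j ∈ Finset.univ.erase i,
        φ.rate (η i) (η j) (site N i) (site N j)
          * (testSum g (moveParticle η i j) - testSum g η) ^ 2 := by
    rw [generator_eq, generator_eq, mul_left_comm, ← mul_sub, Finset.mul_sum,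
      ← Finset.sum_sub_distrib]
    congr 1
    refine Finset.sum_congr rfl fun i _ => ?_
    rw [Finset.mul_sum, ← Finset.sum_sub_distrib]
    exact Finset.sum_congr rfl fun j _ => by ring
  rw [e]
  refine abs_average_le _ (by positivity) fun i => ?_
  have hN : (0 : ℝ) < N := by exact_mod_cast i.pos
  refine (Finset.abs_sum_le_sum_abs _ _).trans ((Finset.sum_le_card_nsmul _ _
    (φ.bound * (4 / N) ^ 2) fun j hj => ?_).trans ?_)
  · rw [abs_mul, abs_pow]
    gcongr
    · exact φ.abs_le_bound _ _ _ _
    · exact abs_testSum_moveParticle_le hg η (Finset.ne_of_mem_erase hj).symm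
  · rw [nsmul_eq_mul]
    have : ((Finset.univ.erase i).card : ℝ) ≤ N := by
      exact_mod_cast (Finset.card_erase_le.trans_eq (by simp))
    calc _ ≤ (N : ℝ) * (φ.bound * (4 / N) ^ 2) := by gcongr
      _ = 16 * φ.bound / N := by field_simp; ring

/-- The empirical version of `outRate`. -/
def outField (η : Config K N) (k : Fin (K + 1)) (u : UnitAddCircle) : ℝ :=
  testSum (fun j l => φ.rate k l u (site N j)) η

/-- The empirical version of `inRate`. -/
def inField (η : Config K N) (k : Fin (K + 1)) (u : UnitAddCircle) : ℝ :=
  testSum (fun j l => φ.rate l k (site N j) u) η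

/-- Exchanging the roles of `i` and `j` in the arrival terms turns the double sum into empirical
rates. These include the diagonal `j = i`, which the generator omits and which costs the error
`O(1/N)`. -/
theorem abs_generator_testSum_sub_le {g : Fin N → Fin (K + 1) → ℝ} (hg : ∀ i k, |g i k| ≤ 1)
    (η : Config K N) :
    |generator φ N (testSum g) η - (1 / (N : ℝ)) * ∑ i,
      ((g i (lower (η i)) - g i (η i)) * outField φ η (η i) (site N i)
        + (g i (raise (η i)) - g i (η i)) * inField φ η (η i) (site N i))| ≤
      4 * φ.bound / N := by
  have hR := φ.one_le_bound
  set a : Fin N → ℝ := fun i => g i (lower (η i)) - g i (η i) with ha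
  set b : Fin N → ℝ := fun i => g i (raise (η i)) - g i (η i) with hb
  set r : Fin N → Fin N → ℝ := fun i j => φ.rate (η i) (η j) (site N i) (site N j) with hr
  have h1 : generator φ N (testSum g) η = (1 / (N : ℝ)) * ∑ i, ∑ j ∈ Finset.univ.erase i,
      r i j * ((1 / (N : ℝ)) * (a i + b j)) := by
    rw [generator_eq]
    congr 1
    refine Finset.sum_congr rfl fun i _ => Finset.sum_congr rfl fun j hj => ?_
    rw [testSum_moveParticle g η (Finset.ne_of_mem_erase hj).symm]
  have h2 : ∑ i, (a i * outField φ η (η i) (site N i) + b i * inField φ η (η i) (site N i)) =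
      ∑ i, ∑ j, r i j * ((1 / (N : ℝ)) * (a i + b j)) := by
    have h3 : ∑ i, b i * inField φ η (η i) (site N i) =
        ∑ i, ∑ j, r i j * ((1 / (N : ℝ)) * b j) := by
      rw [Finset.sum_comm]
      refine Finset.sum_congr rfl fun i _ => ?_
      rw [inField, testSum, Finset.mul_sum, Finset.mul_sum]
      exact Finset.sum_congr rfl fun j _ => by simp only [hr]; ring
    rw [Finset.sum_add_distrib, h3, ← Finset.sum_add_distrib]
    refine Finset.sum_congr rfl fun i _ => ?_
    rw [outField, testSum, Finset.mul_sum, Finset.mul_sum, ← Finset.sum_add_distrib]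
    exact Finset.sum_congr rfl fun j _ => by simp only [hr]; ring
  rw [h1, h2, ← mul_sub, ← Finset.sum_sub_distrib]
  refine abs_average_le _ (by positivity) fun i => ?_
  rw [← Finset.add_sum_erase _ _ (Finset.mem_univ i), sub_add_cancel_right, abs_neg, abs_mul,
    abs_mul, abs_of_nonneg (by positivity : 0 ≤ 1 / (N : ℝ)), mul_div_right_comm,
    mul_comm _ φ.bound, div_eq_mul_one_div 4, mul_comm (4 : ℝ)]
  gcongr
  · exact φ.abs_le_bound _ _ _ _
  · refine (abs_add_le _ _).trans ?_
    linarith [abs_sub_le_two (hg i) (lower (η i)) (η i),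
      abs_sub_le_two (hg i) (raise (η i)) (η i)]

/-- The average over the positions of the expectations of `g i` under the profile `r`. -/
def profileSum (g : Fin N → Fin (K + 1) → ℝ) (r : Profile K) : ℝ :=
  (1 / (N : ℝ)) * ∑ i, ∑ k, g i k * r k (site N i)

/-- The deviation of the averaged observable from its value under the profile `r`. -/
def deviation (g : Fin N → Fin (K + 1) → ℝ) (r : Profile K) (η : Config K N) : ℝ :=
  testSum g η - profileSum g r

theorem deviation_eq (g : Fin N → Fin (K + 1) → ℝ) (r : Profile K) (η : Config K N) :
    deviation g r η = (1 / (N : ℝ)) * ∑ i, (g i (η i) - ∑ k, g i k * r k (site N i)) := by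
  rw [deviation, testSum, profileSum, ← mul_sub, Finset.sum_sub_distrib]

theorem deviation_combo (a b : ℝ) (g h : Fin N → Fin (K + 1) → ℝ) (r : Profile K)
    (η : Config K N) :
    deviation (a • g + b • h) r η = a * deviation g r η + b * deviation h r η := by
  simp only [deviation_eq, Pi.add_apply, Pi.smul_apply, smul_eq_mul, add_mul,
    Finset.sum_add_distrib, Finset.sum_sub_distrib, Finset.mul_sum, mul_sub, mul_add, mul_assoc]
  simp only [mul_left_comm (1 / (N : ℝ))]
  ring

theorem deviation_smul (a : ℝ) (g : Fin N → Fin (K + 1) → ℝ) (r : Profile K) (η : Config K N) :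
    deviation (a • g) r η = a * deviation g r η := by
  simpa using deviation_combo a 0 g 0 r η

theorem abs_sum_mul_le {a : Fin (K + 1) → ℝ} {r : Profile K} (hr : IsStochastic r)
    (ha : ∀ k, |a k| ≤ 1) (u : UnitAddCircle) : |∑ k, a k * r k u| ≤ 1 := by
  refine (Finset.abs_sum_le_sum_abs _ _).trans
    ((Finset.sum_le_sum fun k _ => ?_).trans_eq (hr.2 u))
  rw [abs_mul, abs_of_nonneg (hr.1 k u)]
  exact mul_le_of_le_one_left (hr.1 k u) (ha k)

theorem abs_local_deviation_le {a : Fin (K + 1) → ℝ} {r : Profile K} (hr : IsStochastic r)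
    (ha : ∀ k, |a k| ≤ 1) (u : UnitAddCircle) (l : Fin (K + 1)) :
    |a l - ∑ k, a k * r k u| ≤ 2 :=
  (abs_sub _ _).trans (by linarith [ha l, abs_sum_mul_le hr ha u])

theorem abs_deviation_le {g : Fin N → Fin (K + 1) → ℝ} (hg : ∀ i k, |g i k| ≤ 1) {r : Profile K}
    (hr : IsStochastic r) (η : Config K N) : |deviation g r η| ≤ 2 := by
  rw [deviation_eq]
  exact abs_average_le _ zero_le_two fun i => abs_local_deviation_le hr (hg i) _ _

/-- The drift of the observables `g` in the environment `r`. -/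
def driftTest (g : Fin N → Fin (K + 1) → ℝ) (r : Profile K) : Fin N → Fin (K + 1) → ℝ :=
  fun i k => levelDrift φ r (g i) k (site N i)

theorem abs_driftTest_le {g : Fin N → Fin (K + 1) → ℝ} (hg : ∀ i k, |g i k| ≤ 1) {r : Profile K}
    (hr : IsStochastic r) (i : Fin N) (k : Fin (K + 1)) :
    |driftTest φ g r i k| ≤ 4 * ((K + 1) * φ.bound) := by
  have hR := φ.one_le_bound
  refine (abs_levelDrift_le φ r (hg i) k _).trans ?_
  exact mul_le_mul_of_nonneg_left (mul_le_of_le_one_right (by positivity) hr.norm_le) (by norm_num)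

/-- By duality the derivative of the profile average is the average of `driftTest` under `r`. The
drift error thus splits into the deviation of `driftTest` and the errors of the empirical rates. -/
theorem abs_drift_sub_le (hK : 1 ≤ K) {g : Fin N → Fin (K + 1) → ℝ} (hg : ∀ i k, |g i k| ≤ 1)
    (r : Profile K) (η : Config K N) :
    |generator φ N (testSum g) η - profileSum g (field φ hK r) - deviation (driftTest φ g r) r η| ≤
      4 * φ.bound / N + (1 / (N : ℝ)) * ∑ i, ∑ k,
        2 * (|outField φ η k (site N i) - outRate φ r k (site N i)|
          + |inField φ η k (site N i) - inRate φ r k (site N i)|) := by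
  have h1 : profileSum g (field φ hK r) = profileSum (driftTest φ g r) r := by
    rw [profileSum, profileSum]
    congr 1
    refine Finset.sum_congr rfl fun i _ => ?_
    simp only [field_apply]
    rw [sum_mul_meanFieldRHS φ hK]
    exact Finset.sum_congr rfl fun m _ => mul_comm _ _
  have h2 := abs_generator_testSum_sub_le φ hg η
  set G := (1 / (N : ℝ)) * ∑ i,
      ((g i (lower (η i)) - g i (η i)) * outField φ η (η i) (site N i)
        + (g i (raise (η i)) - g i (η i)) * inField φ η (η i) (site N i)) with hG
  have h3 : |G - testSum (driftTest φ g r) η| ≤ (1 / (N : ℝ)) * ∑ i, ∑ k,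
        2 * (|outField φ η k (site N i) - outRate φ r k (site N i)|
          + |inField φ η k (site N i) - inRate φ r k (site N i)|) := by
    rw [hG, testSum, ← mul_sub, ← Finset.sum_sub_distrib, abs_mul,
      abs_of_nonneg (by positivity : 0 ≤ 1 / (N : ℝ))]
    gcongr
    refine (Finset.abs_sum_le_sum_abs _ _).trans (Finset.sum_le_sum fun i _ => ?_)
    -- The random level `η i` is replaced by a sum over all levels, so that the errors involve only
    -- deterministic observables.
    refine le_trans ?_ (Finset.single_le_sum
      (f := fun k => 2 * (|outField φ η k (site N i) - outRate φ r k (site N i)|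
          + |inField φ η k (site N i) - inRate φ r k (site N i)|))
      (fun _ _ => by positivity) (Finset.mem_univ (η i)))
    have e : (g i (lower (η i)) - g i (η i)) * outField φ η (η i) (site N i)
        + (g i (raise (η i)) - g i (η i)) * inField φ η (η i) (site N i)
        - driftTest φ g r i (η i) =
        (g i (lower (η i)) - g i (η i))
          * (outField φ η (η i) (site N i) - outRate φ r (η i) (site N i))
        + (g i (raise (η i)) - g i (η i))
          * (inField φ η (η i) (site N i) - inRate φ r (η i) (site N i)) := by
      rw [driftTest, levelDrift]
      ring
    rw [e, mul_add]
    refine (abs_add_le _ _).trans ?_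
    rw [abs_mul, abs_mul]
    gcongr
    · exact abs_sub_le_two (hg i) _ _
    · exact abs_sub_le_two (hg i) _ _
  rw [deviation, h1]
  refine le_trans ?_ ((abs_add_le _ _).trans (add_le_add h2 h3))
  apply le_of_eq
  congr 1
  ring

end Generator

/-! ### Second moments of the deviations and Grönwall's inequality -/

section SecondMoment

variable {K N : ℕ} (φ : JumpRates K)

/-- The second moment of the deviation under the weights `p`. -/
def secondMoment (p : Config K N → ℝ) (r : Profile K) (g : Fin N → Fin (K + 1) → ℝ) : ℝ :=
  ∑ η, p η * deviation g r η ^ 2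

theorem secondMoment_nonneg {p : Config K N → ℝ} (hp : ∀ η, 0 ≤ p η) (r : Profile K)
    (g : Fin N → Fin (K + 1) → ℝ) : 0 ≤ secondMoment p r g :=
  Finset.sum_nonneg fun η _ => mul_nonneg (hp η) (sq_nonneg _)

theorem secondMoment_smul (p : Config K N → ℝ) (r : Profile K) (c : ℝ)
    (g : Fin N → Fin (K + 1) → ℝ) : secondMoment p r (c • g) = c ^ 2 * secondMoment p r g := by
  simp only [secondMoment, deviation_smul, Finset.mul_sum]
  exact Finset.sum_congr rfl fun η _ => by ring

/-- The deviation is linear in the observable, and a weighted sum of squares with nonnegative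
weights is convex. -/
theorem convex_secondMoment_le {p : Config K N → ℝ} (hp : ∀ η, 0 ≤ p η) (r : Profile K) (Y : ℝ) :
    Convex ℝ {g | secondMoment p r g ≤ Y} := by
  intro g hg h hh a b ha hb hab
  refine le_trans (b := a * secondMoment p r g + b * secondMoment p r h) ?_ ?_
  · simp only [secondMoment, Finset.mul_sum, ← Finset.sum_add_distrib]
    refine Finset.sum_le_sum fun η _ => ?_
    rw [deviation_combo]
    have h1 : a * deviation g r η ^ 2 + b * deviation h r η ^ 2
        - (a * deviation g r η + b * deviation h r η) ^ 2
        = a * b * (deviation g r η - deviation h r η) ^ 2 := by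
      rw [show b = 1 - a by linarith]
      ring
    have h2 := mul_nonneg (hp η) (h1 ▸ (by positivity :
      0 ≤ a * b * (deviation g r η - deviation h r η) ^ 2))
    linarith
  · have h1 := mul_le_mul_of_nonneg_left hg ha
    have h2 := mul_le_mul_of_nonneg_left hh hb
    have h3 : a * Y + b * Y = Y := by rw [← add_mul, hab, one_mul]
    linarith

/-- The observables with values `1` and `-1` that are encoded by `s`. -/
def signTest (s : Fin N → Fin (K + 1) → Bool) : Fin N → Fin (K + 1) → ℝ :=
  fun i k => if s i k then 1 else -1

theorem abs_signTest_le (s : Fin N → Fin (K + 1) → Bool) (i : Fin N) (k : Fin (K + 1)) :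
    |signTest s i k| ≤ 1 := by
  unfold signTest
  split_ifs <;> simp

/-- The cube is the convex hull of its vertices, so a bound at the sign observables extends to it.
This reduces the supremum over all observables to finitely many. -/
theorem secondMoment_le_of_signTest {p : Config K N → ℝ} (hp : ∀ η, 0 ≤ p η) {r : Profile K}
    {Y : ℝ} (hY : ∀ s, secondMoment p r (signTest s) ≤ Y) {g : Fin N → Fin (K + 1) → ℝ}
    (hg : ∀ i k, |g i k| ≤ 1) : secondMoment p r g ≤ Y := by
  have hV : (Set.univ.pi fun _ : Fin N => Set.univ.pi fun _ : Fin (K + 1) => ({-1, 1} : Set ℝ)) ⊆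
      {g | secondMoment p r g ≤ Y} := by
    intro v hv
    have : v = signTest fun i k => decide (v i k = 1) := by
      funext i k
      have h := hv i trivial k trivial
      simp only [Set.mem_insert_iff, Set.mem_singleton_iff] at h
      rcases h with h | h <;> simp [signTest, h]
    rw [this]
    exact hY _
  refine convexHull_min hV (convex_secondMoment_le hp r Y) ?_
  simp only [convexHull_pi, convexHull_pair]
  intro i _ k _
  rw [segment_eq_Icc (by norm_num)]
  exact abs_le.1 (hg i k)

theorem secondMoment_le_sq_mul {p : Config K N → ℝ} {r : Profile K} {Y : ℝ}
    (hY : ∀ g : Fin N → Fin (K + 1) → ℝ, (∀ i k, |g i k| ≤ 1) → secondMoment p r g ≤ Y)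
    {g : Fin N → Fin (K + 1) → ℝ} {c : ℝ} (hc : 0 < c) (hg : ∀ i k, |g i k| ≤ c) :
    secondMoment p r g ≤ c ^ 2 * Y := by
  have h := hY (c⁻¹ • g) fun i k => by
    rw [Pi.smul_apply, Pi.smul_apply, smul_eq_mul, abs_mul, abs_of_pos (inv_pos.2 hc)]
    exact inv_mul_le_one_of_le₀ (hg i k) hc.le
  rw [secondMoment_smul, inv_pow] at h
  exact (inv_mul_le_iff₀ (by positivity)).1 h

/-- Riemann sums approximate the rates at the profile `r` up to `δ`. -/
def IsDiscretization (N : ℕ) (r : Profile K) (δ : ℝ) : Prop :=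
  ∀ k l u, |riemannSum N (φ.outKernel k l u * r l) - ∫ v, (φ.outKernel k l u * r l) v| ≤ δ ∧
    |riemannSum N (φ.inKernel k l u * r l) - ∫ v, (φ.inKernel k l u * r l) v| ≤ δ

theorem profileSum_eq_sum_riemannSum (a r : Profile K) :
    profileSum (fun j l => a l (site N j)) r = ∑ l, riemannSum N (a l * r l) := by
  simp only [profileSum, riemannSum, ContinuousMap.mul_apply]
  rw [Finset.sum_comm, Finset.mul_sum]

theorem abs_sum_sub_le {a b : Fin (K + 1) → ℝ} {δ : ℝ} (h : ∀ l, |a l - b l| ≤ δ) :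
    |∑ l, a l - ∑ l, b l| ≤ (K + 1) * δ := by
  rw [← Finset.sum_sub_distrib]
  refine (Finset.abs_sum_le_sum_abs _ _).trans
    ((Finset.sum_le_card_nsmul _ _ δ fun l _ => h l).trans_eq (by simp))

theorem abs_outField_sub_le {r : Profile K} {δ : ℝ} (hδ : IsDiscretization φ N r δ)
    (η : Config K N) (k : Fin (K + 1)) (u : UnitAddCircle) :
    |outField φ η k u - outRate φ r k u| ≤
      |deviation (fun j l => φ.outKernel k l u (site N j)) r η| + (K + 1) * δ := by
  have h : |profileSum (fun j l => φ.outKernel k l u (site N j)) r - outRate φ r k u| ≤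
      (K + 1) * δ := by
    rw [profileSum_eq_sum_riemannSum fun l => φ.outKernel k l u, outRate_eq]
    exact abs_sum_sub_le fun l => (hδ k l u).1
  refine le_trans (le_of_eq ?_) ((abs_add_le _ _).trans (add_le_add_right h _))
  rw [deviation, outField]
  simp

theorem abs_inField_sub_le {r : Profile K} {δ : ℝ} (hδ : IsDiscretization φ N r δ)
    (η : Config K N) (k : Fin (K + 1)) (u : UnitAddCircle) :
    |inField φ η k u - inRate φ r k u| ≤
      |deviation (fun j l => φ.inKernel k l u (site N j)) r η| + (K + 1) * δ := by
  have h : |profileSum (fun j l => φ.inKernel k l u (site N j)) r - inRate φ r k u| ≤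
      (K + 1) * δ := by
    rw [profileSum_eq_sum_riemannSum fun l => φ.inKernel k l u, inRate_eq]
    exact abs_sum_sub_le fun l => (hδ k l u).2
  refine le_trans (le_of_eq ?_) ((abs_add_le _ _).trans (add_le_add_right h _))
  rw [deviation, inField]
  simp

/-- The derivative of the second moment at the time of `r`. -/
def secondMomentDeriv (hK : 1 ≤ K) (p : Config K N → ℝ) (r : Profile K)
    (g : Fin N → Fin (K + 1) → ℝ) : ℝ :=
  ∑ η, p η * (generator φ N (fun ξ => (testSum g ξ - profileSum g r) ^ 2) η
    - 2 * deviation g r η * profileSum g (field φ hK r))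

/-- Each product of two deviations is split into squares by Young's inequality; in products with an
error of order `δ`, the deviation is bounded by `2`. Only squares remain, whose expectations are
second moments. -/
theorem pointwise_drift_le (hK : 1 ≤ K) {g : Fin N → Fin (K + 1) → ℝ} (hg : ∀ i k, |g i k| ≤ 1)
    {r : Profile K} (hr : IsStochastic r) {δ : ℝ} (hN : 1 / (N : ℝ) ≤ δ)
    (hδ : IsDiscretization φ N r δ) (η : Config K N) :
    |generator φ N (fun ξ => (testSum g ξ - profileSum g r) ^ 2) η
      - 2 * deviation g r η * profileSum g (field φ hK r)| ≤
    deviation g r η ^ 2 + deviation (driftTest φ g r) r η ^ 2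
      + (1 / (N : ℝ)) * (∑ i, ∑ k, (4 * deviation g r η ^ 2
        + 2 * deviation (fun j l => φ.outKernel k l (site N i) (site N j)) r η ^ 2
        + 2 * deviation (fun j l => φ.inKernel k l (site N i) (site N j)) r η ^ 2))
      + (32 * φ.bound + 16 * (K + 1) ^ 2) * δ := by
  have hR := φ.one_le_bound
  have h1 := abs_generator_sq_sub_le φ hg (profileSum g r) η
  have h2 := abs_drift_sub_le φ hK hg r η
  have hd := abs_deviation_le hg hr η
  have hNδ : ∀ c : ℝ, 0 ≤ c → c / N ≤ c * δ := fun c hc => by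
    rw [div_eq_mul_one_div]
    gcongr
  have hδ0 : 0 ≤ δ := le_trans (by positivity) hN
  set d := deviation g r η with hd_def
  set d' := deviation (driftTest φ g r) r η
  set A : Fin N → Fin (K + 1) → ℝ := fun i k =>
    deviation (fun j l => φ.outKernel k l (site N i) (site N j)) r η
  set B : Fin N → Fin (K + 1) → ℝ := fun i k =>
    deviation (fun j l => φ.inKernel k l (site N i) (site N j)) r η
  set X := generator φ N (testSum g) η - profileSum g (field φ hK r)
  have h3 : 2 * |d| * |X| ≤ d ^ 2 + d' ^ 2
      + (1 / (N : ℝ)) * (∑ i, ∑ k, (4 * d ^ 2 + 2 * A i k ^ 2 + 2 * B i k ^ 2))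
      + (16 * φ.bound + 16 * (K + 1) ^ 2) * δ := by
    have hX : |X| ≤ |d'| + (4 * φ.bound / N + (1 / (N : ℝ)) * ∑ i, ∑ k,
        2 * (|outField φ η k (site N i) - outRate φ r k (site N i)|
          + |inField φ η k (site N i) - inRate φ r k (site N i)|)) := by
      have := abs_add_le d' (X - d')
      rw [add_sub_cancel] at this
      linarith
    have hS : 2 * |d| * ((1 / (N : ℝ)) * ∑ i, ∑ k,
        2 * (|outField φ η k (site N i) - outRate φ r k (site N i)|
          + |inField φ η k (site N i) - inRate φ r k (site N i)|)) ≤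
        (1 / (N : ℝ)) * (∑ i, ∑ k, (4 * d ^ 2 + 2 * A i k ^ 2 + 2 * B i k ^ 2))
          + 16 * (K + 1) ^ 2 * δ := by
      have hpt : ∀ i : Fin N, 2 * |d| * ∑ k,
          (2 * (|outField φ η k (site N i) - outRate φ r k (site N i)|
          + |inField φ η k (site N i) - inRate φ r k (site N i)|)) ≤
          (∑ k, (4 * d ^ 2 + 2 * A i k ^ 2 + 2 * B i k ^ 2)) + 16 * (K + 1) ^ 2 * δ := by
        intro i
        have hk : ∀ k, 2 * |d| *
            (2 * (|outField φ η k (site N i) - outRate φ r k (site N i)|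
            + |inField φ η k (site N i) - inRate φ r k (site N i)|)) ≤
            (4 * d ^ 2 + 2 * A i k ^ 2 + 2 * B i k ^ 2) + 16 * (K + 1) * δ := by
          intro k
          have ho : _ ≤ |A i k| + _ := abs_outField_sub_le φ hδ η k (site N i)
          have hi : _ ≤ |B i k| + _ := abs_inField_sub_le φ hδ η k (site N i)
          have e1 : 2 * |d| * (2 * (|outField φ η k (site N i) - outRate φ r k (site N i)|
            + |inField φ η k (site N i) - inRate φ r k (site N i)|)) ≤
              2 * |d| * (2 * ((|A i k| + (K + 1) * δ) + (|B i k| + (K + 1) * δ))) := by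
            gcongr
          have e2 : |d| * ((K + 1) * δ) ≤ 2 * ((K + 1) * δ) := by gcongr
          have e3 := sq_nonneg (|d| - |A i k|)
          have e4 := sq_nonneg (|d| - |B i k|)
          have e5 := sq_abs d
          have e6 := sq_abs (A i k)
          have e7 := sq_abs (B i k)
          nlinarith
        rw [Finset.mul_sum]
        refine (Finset.sum_le_sum fun k _ => hk k).trans_eq ?_
        rw [Finset.sum_add_distrib]
        simp
        ring
      have hc : (1 / (N : ℝ)) * ∑ _i : Fin N, 16 * (K + 1) ^ 2 * δ ≤ 16 * (K + 1) ^ 2 * δ :=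
        average_le (by positivity) fun _ => le_rfl
      rw [mul_left_comm, Finset.mul_sum]
      refine (average_mono hpt).trans ?_
      rw [Finset.sum_add_distrib, mul_add]
      linarith
    have hq : 2 * |d| * |d'| ≤ d ^ 2 + d' ^ 2 := by
      have := two_mul_le_add_sq |d| |d'|
      rwa [sq_abs, sq_abs] at this
    have hb : 2 * |d| * (4 * φ.bound / N) ≤ 16 * φ.bound * δ := by
      have e1 := hNδ (4 * φ.bound) (by positivity)
      calc 2 * |d| * (4 * φ.bound / N) ≤ 2 * 2 * (4 * φ.bound * δ) := by gcongr
        _ = 16 * φ.bound * δ := by ring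
    have := mul_le_mul_of_nonneg_left hX (by positivity : 0 ≤ 2 * |d|)
    rw [mul_add, mul_add] at this
    linarith
  have h4 := hNδ (16 * φ.bound) (by positivity)
  have h5 : |generator φ N (fun ξ => (testSum g ξ - profileSum g r) ^ 2) η
      - 2 * d * profileSum g (field φ hK r)| ≤ 16 * φ.bound / N + 2 * |d| * |X| := by
    have e : generator φ N (fun ξ => (testSum g ξ - profileSum g r) ^ 2) η
        - 2 * d * profileSum g (field φ hK r) =
        (generator φ N (fun ξ => (testSum g ξ - profileSum g r) ^ 2) η
          - 2 * (testSum g η - profileSum g r) * generator φ N (testSum g) η) + 2 * d * X := by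
      rw [hd_def, deviation]
      ring
    rw [e]
    refine (abs_add_le _ _).trans (add_le_add h1 ?_)
    rw [abs_mul, abs_mul, abs_two]
  linarith

/-- The rate of growth of the second moments. -/
def growthRate : ℝ :=
  1 + (4 * ((K + 1) * φ.bound)) ^ 2 + (K + 1) * (4 + 4 * φ.bound ^ 2)

/-- This closes the estimate: every second moment on the right belongs to an observable with a bound
independent of `N`, hence is a multiple of `Y` by homogeneity. The terms of `growthRate` come from
`g`, from `driftTest` and from the kernels. -/
theorem abs_secondMomentDeriv_le (hK : 1 ≤ K) {p : Config K N → ℝ} (hp : ∀ η, 0 ≤ p η)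
    (hp1 : ∑ η, p η = 1) {r : Profile K} (hr : IsStochastic r) {δ Y : ℝ}
    (hN : 1 / (N : ℝ) ≤ δ) (hδ : IsDiscretization φ N r δ)
    (hY : ∀ g : Fin N → Fin (K + 1) → ℝ, (∀ i k, |g i k| ≤ 1) → secondMoment p r g ≤ Y)
    {g : Fin N → Fin (K + 1) → ℝ} (hg : ∀ i k, |g i k| ≤ 1) :
    |secondMomentDeriv φ hK p r g| ≤
      growthRate φ * Y + (32 * φ.bound + 16 * (K + 1) ^ 2) * δ := by
  have hR := φ.one_le_bound
  have hY0 : 0 ≤ Y := (secondMoment_nonneg hp r g).trans (hY g hg)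
  have h1 : |secondMomentDeriv φ hK p r g| ≤ ∑ η, p η * (deviation g r η ^ 2
      + deviation (driftTest φ g r) r η ^ 2
      + (1 / (N : ℝ)) * (∑ i, ∑ k, (4 * deviation g r η ^ 2
        + 2 * deviation (fun j l => φ.outKernel k l (site N i) (site N j)) r η ^ 2
        + 2 * deviation (fun j l => φ.inKernel k l (site N i) (site N j)) r η ^ 2))
      + (32 * φ.bound + 16 * (K + 1) ^ 2) * δ) := by
    refine (Finset.abs_sum_le_sum_abs _ _).trans (Finset.sum_le_sum fun η _ => ?_)
    rw [abs_mul, abs_of_nonneg (hp η)]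
    exact mul_le_mul_of_nonneg_left (pointwise_drift_le φ hK hg hr hN hδ η) (hp η)
  have h2 : ∑ η, p η * (deviation g r η ^ 2
      + deviation (driftTest φ g r) r η ^ 2
      + (1 / (N : ℝ)) * (∑ i, ∑ k, (4 * deviation g r η ^ 2
        + 2 * deviation (fun j l => φ.outKernel k l (site N i) (site N j)) r η ^ 2
        + 2 * deviation (fun j l => φ.inKernel k l (site N i) (site N j)) r η ^ 2))
      + (32 * φ.bound + 16 * (K + 1) ^ 2) * δ) =
      secondMoment p r g + secondMoment p r (driftTest φ g r)
      + (1 / (N : ℝ)) * (∑ i, ∑ k, (4 * secondMoment p r g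
        + 2 * secondMoment p r (fun j l => φ.outKernel k l (site N i) (site N j))
        + 2 * secondMoment p r (fun j l => φ.inKernel k l (site N i) (site N j))))
      + (32 * φ.bound + 16 * (K + 1) ^ 2) * δ := by
    simp_rw [mul_add (p _)]
    rw [Finset.sum_add_distrib, Finset.sum_add_distrib, Finset.sum_add_distrib, ← Finset.sum_mul,
      hp1, one_mul]
    refine congrArg₂ _ (congrArg₂ _ rfl ?_) rfl
    simp only [secondMoment, Finset.mul_sum (s := (Finset.univ : Finset (Fin N))),
      Finset.mul_sum (s := (Finset.univ : Finset (Fin (K + 1))))]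
    rw [Finset.sum_comm]
    refine Finset.sum_congr rfl fun i _ => ?_
    rw [Finset.sum_comm]
    refine Finset.sum_congr rfl fun k _ => ?_
    simp only [← Finset.sum_add_distrib, Finset.mul_sum]
    exact Finset.sum_congr rfl fun η _ => by ring
  have h3 : secondMoment p r (driftTest φ g r) ≤ (4 * ((K + 1) * φ.bound)) ^ 2 * Y :=
    secondMoment_le_sq_mul hY (by positivity) (abs_driftTest_le φ hg hr)
  have h4 : (1 / (N : ℝ)) * (∑ i, ∑ k, (4 * secondMoment p r g
        + 2 * secondMoment p r (fun j l => φ.outKernel k l (site N i) (site N j))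
        + 2 * secondMoment p r (fun j l => φ.inKernel k l (site N i) (site N j)))) ≤
      (K + 1) * (4 + 4 * φ.bound ^ 2) * Y := by
    refine average_le (by positivity) fun i => ?_
    refine (Finset.sum_le_card_nsmul _ _ (4 * Y + 2 * (φ.bound ^ 2 * Y) + 2 * (φ.bound ^ 2 * Y))
      fun k _ => ?_).trans_eq ?_
    · gcongr
      · exact hY g hg
      · exact secondMoment_le_sq_mul hY (by positivity) fun j l => φ.abs_le_bound k l _ _
      · exact secondMoment_le_sq_mul hY (by positivity) fun j l => φ.abs_le_bound l k _ _
    · simp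
      ring
  rw [h2] at h1
  have h5 := hY g hg
  rw [growthRate]
  linarith

theorem hasDerivWithinAt_secondMoment (hK : 1 ≤ K) {p : ℝ → Config K N → ℝ}
    (hp : IsForwardSolution (generatorMatrix φ N) p) {α : ℝ → Profile K} {s : Set ℝ} {t : ℝ}
    (hα : HasDerivWithinAt α (field φ hK (α t)) s t) (g : Fin N → Fin (K + 1) → ℝ) :
    HasDerivWithinAt (fun s => secondMoment (p s) (α s) g)
      (secondMomentDeriv φ hK (p t) (α t) g) s t := by
  have h1 : HasDerivWithinAt (fun s => profileSum g (α s)) (profileSum g (field φ hK (α t))) s t := by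
    unfold profileSum
    exact HasDerivWithinAt.const_mul _ (HasDerivWithinAt.fun_sum fun i _ =>
      HasDerivWithinAt.fun_sum fun k _ =>
        (hasDerivWithinAt_eval hα k (site N i)).const_mul (g i k))
  have h2 := hp.hasDerivWithinAt_sum (F := fun s η => deviation g (α s) η ^ 2)
    fun η => (h1.const_sub (testSum g η)).pow 2
  refine h2.congr_deriv (Finset.sum_congr rfl fun η _ => ?_)
  rw [sum_generatorMatrix_mul]
  simp only [deviation]
  push_cast
  ring

/-- The centred local observables are independent under the product law, so the mixed terms vanish.
The `N` diagonal terms are at most `4` each and carry the factor `1/N²`. -/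
theorem secondMoment_initial_le {p : Config K N → ℝ} {r : Profile K} (hr : IsStochastic r)
    (hp : ∀ η, p η = ∏ i, r (η i) (site N i)) {g : Fin N → Fin (K + 1) → ℝ}
    (hg : ∀ i k, |g i k| ≤ 1) : secondMoment p r g ≤ 4 * (1 / (N : ℝ)) := by
  set a : Fin N → Fin (K + 1) → ℝ := fun i l => g i l - ∑ k, g i k * r k (site N i)
  have hmean : ∀ i, ∑ l, r l (site N i) * a i l = 0 := fun i => by
    simp only [a, mul_sub, Finset.sum_sub_distrib, ← Finset.sum_mul, hr.2, one_mul]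
    simp [mul_comm]
  have hdiag : ∀ i, ∑ η : Config K N, p η * (a i (η i) * a i (η i)) ≤ 4 := fun i => by
    have hone : ∑ η : Config K N, p η = 1 := by
      simp only [hp]
      rw [← Fintype.prod_sum fun (i : Fin N) (k : Fin (K + 1)) => r k (site N i)]
      simp [hr.2]
    refine (Finset.sum_le_sum (g := fun η => p η * 4) fun η _ => ?_).trans_eq ?_
    · refine mul_le_mul_of_nonneg_left ?_ (hp η ▸ Finset.prod_nonneg fun i _ => hr.1 _ _)
      have := abs_le.1 (abs_local_deviation_le hr (hg i) (site N i) (η i))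
      change a i (η i) * a i (η i) ≤ 4
      have h1 : -2 ≤ a i (η i) := this.1
      have h2 : a i (η i) ≤ 2 := this.2
      nlinarith
    · rw [← Finset.sum_mul, hone, one_mul]
  have hoff : ∀ i j, i ≠ j → ∑ η : Config K N, p η * (a i (η i) * a j (η j)) = 0 := by
    intro i j hij
    -- Written as a product over the positions, the sum over configurations factorizes, and the
    -- factor at `i` is the mean of `a i`, which is `0`.
    have e : ∀ η : Config K N, p η * (a i (η i) * a j (η j)) =
        ∏ m, (r (η m) (site N m) * ((if m = i then a m (η m) else 1)
          * (if m = j then a m (η m) else 1))) := fun η => by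
      rw [Finset.prod_mul_distrib, Finset.prod_mul_distrib, hp]
      simp
    simp only [e]
    rw [← Fintype.prod_sum fun (m : Fin N) (k : Fin (K + 1)) =>
      r k (site N m) * ((if m = i then a m k else 1) * (if m = j then a m k else 1))]
    exact Finset.prod_eq_zero (Finset.mem_univ i) (by simpa [hij] using hmean i)
  have hsum : secondMoment p r g = (1 / (N : ℝ)) * ((1 / (N : ℝ)) *
      ∑ i, ∑ η : Config K N, p η * (a i (η i) * a i (η i))) := by
    have e : ∀ η : Config K N, p η * deviation g r η ^ 2 = (1 / (N : ℝ)) * ((1 / (N : ℝ)) *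
        ∑ i, ∑ j, p η * (a i (η i) * a j (η j))) := fun η => by
      rw [deviation_eq]
      change p η * ((1 / (N : ℝ)) * ∑ i, a i (η i)) ^ 2 = _
      simp only [← Finset.mul_sum]
      rw [← Finset.sum_mul]
      ring
    simp only [secondMoment, e]
    rw [← Finset.mul_sum, ← Finset.mul_sum, Finset.sum_comm]
    congr 2
    refine Finset.sum_congr rfl fun i _ => ?_
    rw [Finset.sum_comm]
    exact Finset.sum_eq_single i (fun j _ hj => hoff i j hj.symm) (by simp)
  rw [hsum, mul_comm 4]
  gcongr
  exact average_le (by norm_num) hdiag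

/-- The growth constant of the second moments up to time `T`. -/
def growthFactor (T : ℝ) : ℝ :=
  4 * Real.exp (growthRate φ * T)
    + (32 * φ.bound + 16 * (K + 1) ^ 2) / growthRate φ * (Real.exp (growthRate φ * T) - 1)

theorem growthRate_pos : 0 < growthRate φ := by
  have := φ.one_le_bound
  unfold growthRate
  positivity

theorem secondMoment_le (hK : 1 ≤ K) {p : ℝ → Config K N → ℝ}
    (hp : IsForwardSolution (generatorMatrix φ N) p) {α : ℝ → Profile K} {T δ : ℝ} (hT : 0 ≤ T)
    (hα : ∀ t, 0 ≤ t → HasDerivWithinAt α (field φ hK (α t)) (Set.Ici 0) t)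
    (hr : ∀ t, 0 ≤ t → IsStochastic (α t)) (h0 : ∀ η, p 0 η = ∏ i, α 0 (η i) (site N i))
    (hN : 1 / (N : ℝ) ≤ δ) (hδ : ∀ t ∈ Set.Icc 0 T, IsDiscretization φ N (α t) δ)
    {g : Fin N → Fin (K + 1) → ℝ} (hg : ∀ i k, |g i k| ≤ 1) :
    secondMoment (p T) (α T) g ≤ growthFactor φ T * δ := by
  have hR := φ.one_le_bound
  have hδ0 : 0 ≤ δ := le_trans (by positivity) hN
  set y : ℝ → (Fin N → Fin (K + 1) → Bool) → ℝ := fun t s =>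
    secondMoment (p t) (α t) (signTest s)
  have hy : ∀ t, 0 ≤ t → HasDerivWithinAt y
      (fun s => secondMomentDeriv φ hK (p t) (α t) (signTest s)) (Set.Ici 0) t := fun t ht =>
    hasDerivWithinAt_pi.2 fun s => hasDerivWithinAt_secondMoment φ hK hp (hα t ht) _
  have hle : ∀ t, 0 ≤ t → ∀ g : Fin N → Fin (K + 1) → ℝ, (∀ i k, |g i k| ≤ 1) →
      secondMoment (p t) (α t) g ≤ ‖y t‖ := fun t ht g hg =>
    secondMoment_le_of_signTest (hp.nonneg t ht)
      (fun s => (le_abs_self _).trans (norm_le_pi_norm (y t) s)) hg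
  -- Grönwall in the maximum norm over all choices of signs. The initial bound `4 * δ` uses `1/N ≤
  -- δ`.
  have key := norm_le_gronwallBound_of_norm_deriv_right_le (f := y)
    (f' := fun t s => secondMomentDeriv φ hK (p t) (α t) (signTest s)) (δ := 4 * δ)
    (K := growthRate φ) (ε := (32 * φ.bound + 16 * (K + 1) ^ 2) * δ) (a := 0) (b := T)
    (fun t ht => ((hy t ht.1).continuousWithinAt).mono Set.Icc_subset_Ici_self)
    (fun t ht => (hy t ht.1).mono (Set.Ici_subset_Ici.2 ht.1))
    ((pi_norm_le_iff_of_nonneg (by positivity)).2 fun s => by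
      rw [Real.norm_eq_abs, abs_of_nonneg (secondMoment_nonneg (hp.nonneg 0 le_rfl) _ _)]
      refine (secondMoment_initial_le (hr 0 le_rfl) h0 (abs_signTest_le s)).trans ?_
      gcongr)
    (fun t ht => (pi_norm_le_iff_of_nonneg (by
        have := growthRate_pos φ
        positivity)).2 fun s =>
      abs_secondMomentDeriv_le φ hK (hp.nonneg t ht.1) (hp.sum_eq_one t ht.1) (hr t ht.1) hN
        (hδ t ⟨ht.1, ht.2.le⟩) (hle t ht.1) (abs_signTest_le s))
    T ⟨hT, le_rfl⟩
  refine (hle T hT g hg).trans (key.trans_eq ?_)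
  rw [gronwallBound_of_K_ne_0 (growthRate_pos φ).ne', growthFactor]
  simp only [sub_zero]
  ring

end SecondMoment

/-! ### Passage to the limit -/

section Convergence

variable {K : ℕ} (φ : JumpRates K)

/-- The products of kernel and profile, over all `t ∈ [0, T]` and all `u`, form a continuous image
of a compact set, on which Riemann sums converge uniformly. -/
theorem eventually_isDiscretization {α : ℝ → Profile K} {T : ℝ}
    (hα : ContinuousOn α (Set.Icc 0 T)) {δ : ℝ} (hδ : 0 < δ) :
    ∀ᶠ N in Filter.atTop, ∀ t ∈ Set.Icc 0 T, IsDiscretization φ N (α t) δ := by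
  have hker : ∀ (a : UnitAddCircle → C(UnitAddCircle, ℝ)), Continuous a → ∀ l,
      ∀ᶠ N in Filter.atTop, ∀ t ∈ Set.Icc 0 T, ∀ u,
        |riemannSum N (a u * α t l) - ∫ v, (a u * α t l) v| ≤ δ := by
    intro a ha l
    have hc : ContinuousOn (fun q : ℝ × UnitAddCircle => a q.2 * α q.1 l)
        (Set.Icc 0 T ×ˢ Set.univ) :=
      (ha.comp continuous_snd).continuousOn.mul
        ((continuous_apply l).comp_continuousOn
          (hα.comp continuous_fst.continuousOn fun q hq => hq.1))
    filter_upwards [eventually_riemannSum_sub_le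
      ((isCompact_Icc.prod isCompact_univ).image_of_continuousOn hc) hδ] with N hN t ht u
    exact hN _ ⟨(t, u), ⟨ht, trivial⟩, rfl⟩
  have h := Filter.eventually_all.2 fun k => Filter.eventually_all.2 fun l =>
    (hker _ (φ.continuous_outKernel k l) l).and (hker _ (φ.continuous_inKernel k l) l)
  filter_upwards [h] with N hN t ht k l u
  exact ⟨(hN k l).1 t ht u, (hN k l).2 t ht u⟩

/-- The observables whose average is the empirical measure of level `k` at `f`. -/
def levelTest (N : ℕ) (k : Fin (K + 1)) (f : C(UnitAddCircle, ℝ)) : Fin N → Fin (K + 1) → ℝ :=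
  fun i l => if l = k then f (site N i) else 0

theorem deviation_levelTest {N : ℕ} (k : Fin (K + 1)) (f : C(UnitAddCircle, ℝ)) (r : Profile K)
    (η : Config K N) :
    deviation (levelTest N k f) r η = empirical η k f - riemannSum N (r k * f) := by
  simp [deviation, testSum, profileSum, levelTest, empirical, riemannSum, mul_comm]

theorem tendsto_sum_sq {p : ∀ N, ℝ → Config K N → ℝ} {α : ℝ → Profile K} (hK : 1 ≤ K)
    (hp : ∀ N, 1 ≤ N → IsForwardSolution (generatorMatrix φ N) (p N))
    (hα : ∀ t, 0 ≤ t → HasDerivWithinAt α (field φ hK (α t)) (Set.Ici 0) t)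
    (hr : ∀ t, 0 ≤ t → IsStochastic (α t))
    (h0 : ∀ N, 1 ≤ N → ∀ η, p N 0 η = ∏ i, α 0 (η i) (site N i))
    {T : ℝ} (hT : 0 ≤ T) (k : Fin (K + 1)) (f : C(UnitAddCircle, ℝ)) :
    Filter.Tendsto (fun N => ∑ η, p N T η * (empirical η k f - ∫ u, (α T k * f) u) ^ 2)
      Filter.atTop (nhds 0) := by
  -- The factors `2` come from `(x - z)² ≤ 2 (x - y)² + 2 (y - z)²`, where `y` is the Riemann sum;
  -- `‖f‖ + 1` is a positive bound of the observable.
  set C : ℝ := 2 * ((‖f‖ + 1) ^ 2 * growthFactor φ T) + 2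
  rw [Metric.tendsto_nhds]
  intro ε hε
  have hCpos : 0 < |C| + 1 := by positivity
  -- The cap at `1` allows `δ²` to be replaced by `δ`.
  set δ : ℝ := min 1 (ε / (2 * (|C| + 1)))
  have hδ : 0 < δ := lt_min one_pos (by positivity)
  have hδ1 : δ ≤ 1 := min_le_left _ _
  have hCδ : C * δ < ε := by
    calc C * δ ≤ (|C| + 1) * (ε / (2 * (|C| + 1))) :=
          mul_le_mul ((le_abs_self C).trans (by linarith)) (min_le_right _ _) hδ.le hCpos.le
      _ = ε / 2 := by field_simp
      _ < ε := by linarith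
  have hcont : ContinuousOn α (Set.Icc 0 T) := fun t ht =>
    (hα t ht.1).continuousWithinAt.mono Set.Icc_subset_Ici_self
  filter_upwards [eventually_isDiscretization φ hcont hδ, Filter.eventually_ge_atTop 1,
    (tendsto_one_div_atTop_nhds_zero_nat (𝕜 := ℝ)).eventually (ge_mem_nhds hδ),
    Metric.tendsto_nhds.1 (tendsto_riemannSum (α T k * f)) δ hδ] with N hdisc hN1 hNδ hriem
  have hnn := (hp N hN1).nonneg T hT
  have hmom : secondMoment (p N T) (α T) (levelTest N k f) ≤
      (‖f‖ + 1) ^ 2 * (growthFactor φ T * δ) := by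
    refine secondMoment_le_sq_mul (fun g hg => secondMoment_le φ hK (hp N hN1) hT hα hr
      (h0 N hN1) hNδ hdisc hg) (by positivity) fun i l => ?_
    unfold levelTest
    split_ifs
    · exact (f.norm_coe_le_norm _).trans (by linarith)
    · rw [abs_zero]
      positivity
  have hle : ∑ η, p N T η * (empirical η k f - ∫ u, (α T k * f) u) ^ 2 ≤
      2 * secondMoment (p N T) (α T) (levelTest N k f) + 2 * δ := by
    have e : 2 * secondMoment (p N T) (α T) (levelTest N k f) + 2 * δ =
        ∑ η, p N T η * (2 * deviation (levelTest N k f) (α T) η ^ 2 + 2 * δ) := by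
      simp only [mul_add, Finset.sum_add_distrib]
      rw [← Finset.sum_mul, (hp N hN1).sum_eq_one T hT, one_mul, secondMoment, Finset.mul_sum]
      simp only [mul_left_comm]
    rw [e]
    refine Finset.sum_le_sum fun η _ => mul_le_mul_of_nonneg_left ?_ (hnn η)
    rw [deviation_levelTest]
    set x := empirical η k f
    set y := riemannSum N (α T k * f)
    set z := ∫ u, (α T k * f) u
    rw [Real.dist_eq] at hriem
    have h1 : (y - z) ^ 2 ≤ δ := by
      rw [← sq_abs]
      have := abs_nonneg (y - z)
      nlinarith
    nlinarith [sq_nonneg ((x - y) - (y - z))]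
  rw [Real.dist_eq, sub_zero, abs_of_nonneg
    (Finset.sum_nonneg fun η _ => mul_nonneg (hnn η) (sq_nonneg _))]
  calc _ ≤ 2 * ((‖f‖ + 1) ^ 2 * (growthFactor φ T * δ)) + 2 * δ := by linarith
    _ = C * δ := by simp only [C]; ring
    _ < ε := hCδ

theorem eLpNorm_two_comp_eq {S Ω : Type*} [Fintype S] [MeasurableSpace Ω]
    {P : MeasureTheory.Measure Ω} [MeasureTheory.IsProbabilityMeasure P] {Z : Ω → S}
    (hZ : ∀ x, MeasurableSet {ω | Z ω = x}) (F : S → ℝ) :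
    MeasureTheory.eLpNorm (fun ω => F (Z ω)) 2 P =
      ENNReal.ofReal (√(∑ x, P.real {ω | Z ω = x} * F x ^ 2)) := by
  classical
  obtain ⟨hm, hi⟩ := integral_comp_eq_sum (P := P) hZ F
  rw [hm.eLpNorm_eq_integral_rpow_norm (by norm_num) (by norm_num), Real.sqrt_eq_rpow, ← hi]
  simp

end Convergence

end MeanField

end

theorem theorem2p1 (K : ℕ) (φ : MeanField.JumpRates K) (ψ : UnitAddCircle → ℝ)
    (hψ : ψ ∈ MeanField.admissibleProfiles K) :
    ∃ ρ : ℝ≥0 → Fin (K + 1) → C(UnitAddCircle, ℝ),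
      MeanField.IsMeanFieldSolution φ ψ ρ ∧
      (∀ ρ' : ℝ≥0 → Fin (K + 1) → C(UnitAddCircle, ℝ),
        MeanField.IsMeanFieldSolution φ ψ ρ' → ρ' = ρ) ∧
      ∀ (Ω : ℕ → Type*) [∀ N, MeasurableSpace (Ω N)]
        (P : ∀ N, MeasureTheory.Measure (Ω N)) [∀ N, MeasureTheory.IsProbabilityMeasure (P N)]
        (η : ∀ N, ℝ≥0 → Ω N → MeanField.Config K N),
        (∀ N, 1 ≤ N →
          MeanField.IsMarkovProcess (MeanField.generatorMatrix φ N) (P N) (η N) ∧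
          MeanField.HasBinomialLaw ψ (P N) (η N 0)) →
        ∀ (t : ℝ≥0) (k : Fin (K + 1)) (f : C(UnitAddCircle, ℝ)),
          Filter.Tendsto
            (fun N => MeasureTheory.eLpNorm
              (fun ω => MeanField.empirical (η N t ω) k f
                - ∫ u : UnitAddCircle, ρ t k u * f u) 2 (P N))
            Filter.atTop (nhds 0) := by
  -- The condition `0 < ψ < K` at a single point already excludes `K = 0`.
  have hK : 1 ≤ K := by
    have h := hψ.2 0
    exact_mod_cast h.1.trans h.2
  obtain ⟨ρ, hρ, hs⟩ := MeanField.exists_isMeanFieldSolution φ hK hψ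
  refine ⟨ρ, hρ, fun ρ' hρ' => hρ'.unique φ hK hρ, ?_⟩
  intro Ω _ P _ η h t k f
  choose! p hp hpe using fun N hN => (h N hN).1.exists_forwardSolution
  have key := MeanField.tendsto_sum_sq φ hK hp (α := fun s => ρ s.toNNReal)
    (fun s hs => hρ.hasDerivWithinAt_field φ hK hs) (fun s _ => hs _)
    (fun N hN ξ => by
      have h0 := hpe N hN 0 ξ
      rw [NNReal.coe_zero] at h0
      rw [h0, (h N hN).2 ξ]
      simp [hρ.initial]) t.2 k f
  have hlim := (ENNReal.continuous_ofReal.comp Real.continuous_sqrt).tendsto 0 |>.comp key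
  rw [Function.comp_apply, Real.sqrt_zero, ENNReal.ofReal_zero] at hlim
  refine hlim.congr' ?_
  filter_upwards [Filter.eventually_ge_atTop 1] with N hN
  rw [MeanField.eLpNorm_two_comp_eq ((h N hN).1.measurable t)
    (fun ξ => MeanField.empirical ξ k f - ∫ u : UnitAddCircle, ρ t k u * f u)]
  simp [← hpe N hN]
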